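/- Let $0<\alpha<1$, $\lambda,k,q>0$ and $C\in\mathbb R$. For real $z$, put $$W(z,a,b)=\sum_{n=0}^\infty\frac{z^n}{n!\,\Gamma(an+b)}\qquad(\text{with } 1/\Gamma=0 \text{ at } 0,-1,-2,\dots),\qquad M_\nu(z)=W(-z,-\nu,1-\nu),$$ and let $$D^\alpha f(t)=\frac1{\Gamma(1-\alpha)}\int_0^t (t-\tau)^{-\alpha}f'(\tau)\,d\tau$$ be the Caputo derivative in $t$ with base point $0$. Consider the fractional Stefan problem (St2) for a pair $(u,s)$, where $u$ is a function on the quadrant $x\ge0$, $t>0$ and $s$ a function on $[0,\infty)$ with $s(t)>0$ for $t>0$: $$\begin{cases} D^\alpha u(x,t)=\lambda^2u_{xx}(x,t), & 0<x<s(t),\ t>0,\\ u_x(0,t)=-\dfrac{q}{t^{\alpha/2}}, & t>0,\\ u(s(t),t)=C, & t>0,\\ D^\alpha s(t)=-k\,u_x(s(t),t), & t>0,\\ s(0)=0, \end{cases}$$ where $u_x$ is taken within $[0,s(t)]$ (one-sided at the end points). It is required that all the derivatives in (St2) exist, the integrands in the Caputo derivatives being integrable, and that (a) $u_{xx}$ and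 $D^\alpha u$ are continuous on $\{0<x<s(t),\ t>0\}$; (b) $u$ and $u_x$ are continuous on $\{0\le x\le s(t),\ t>0\}$; (c) $-\infty<\liminf u(x,t)\le\limsup u(x,t)<+\infty$ as $(x,t)\to(0,0)$ within $\{0\le x\le s(t),\ t>0\}$; (d) $s$ is continuous on $[0,\infty)$ and continuously differentiable on $(0,\infty)$, and $\tau\mapsto \dot s(\tau)/(t-\tau)^\alpha$ is in $L^1(0,t)$ for every $t>0$. Then the equation $$J(\mu):=\frac{\mu}{M_{\alpha/2}(\mu)}=\frac{kq}{\lambda}\,\frac{\Gamma(1-\frac\alpha2)^2}{\Gamma(1+\frac\alpha2)}$$ has exactly one positive solution $\tilde\mu$, and the pair $$u_2(x,t)=C+q\lambda\,\Gamma\!\left(1-\tfrac\alpha2\right)\left[W\!\left(-\tfrac{x}{\lambda t^{\alpha/2}},-\tfrac\alpha2,1\right)-W\!\left(-\tilde\mu,-\tfrac\alpha2,1\right)\right],\qquad s_2(t)=\lambda\tilde\mu\,t^{\alpha/2}$$ is a solution of (St2) satisfying (a)–(d). If moreover $C\ge0$, then the lower limit in (c) is also non-negative: $\liminf u_2(x,t)\ge0$.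 -/

import Mathlib

open Set Filter Topology MeasureTheory

noncomputable section

/-- The Wright function `W(z, a, b) = ∑ zⁿ / (n! Γ(a n + b))`, for real arguments.
`Real.Gamma` vanishes at `0, -1, -2, …`, so that the terms at the poles of `Γ` are `0`, as they
should be. -/
def wrightW (z a b : ℝ) : ℝ :=
  ∑' n : ℕ, z ^ n / ((n.factorial : ℝ) * Real.Gamma (a * n + b))

/-- The Mainardi function `M_ν(z) = W(-z, -ν, 1 - ν)`. -/
def mainardiM (ν z : ℝ) : ℝ :=
  wrightW (-z) (-ν) (1 - ν)

/-- `J(μ) = μ / M_{α/2}(μ)`. -/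
def stefanJ (α μ : ℝ) : ℝ :=
  μ / mainardiM (α / 2) μ

/-- The Caputo derivative with base point `0`, of order `α ∈ (0, 1)`:
`D^α f(t) = (1 / Γ(1 - α)) ∫₀ᵗ (t - τ)^(-α) f'(τ) dτ`. -/
def caputoDeriv (α : ℝ) (f : ℝ → ℝ) (t : ℝ) : ℝ :=
  1 / Real.Gamma (1 - α) * ∫ τ in (0 : ℝ)..t, (t - τ) ^ (-α) * deriv f τ

/-- The integral that defines the Caputo derivative of `f` at `t` makes sense: `f` is
differentiable on `(0, t)` and the integrand is integrable. -/
def CaputoDifferentiableAt (α : ℝ) (f : ℝ → ℝ) (t : ℝ) : Prop :=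
  DifferentiableOn ℝ f (Ioo 0 t) ∧
    IntervalIntegrable (fun τ => (t - τ) ^ (-α) * deriv f τ) volume 0 t

/-- The open region `0 < x < s(t)`, `t > 0`, as a set of pairs `(x, t)`. -/
def openRegion (s : ℝ → ℝ) : Set (ℝ × ℝ) :=
  {p | 0 < p.2 ∧ 0 < p.1 ∧ p.1 < s p.2}

/-- The region `0 ≤ x ≤ s(t)`, `t > 0`, as a set of pairs `(x, t)`. -/
def closedRegion (s : ℝ → ℝ) : Set (ℝ × ℝ) :=
  {p | 0 < p.2 ∧ 0 ≤ p.1 ∧ p.1 ≤ s p.2}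

/-- The space derivative `u_x(x, t)` for `0 ≤ x ≤ s(t)`, one-sided at the two end points. -/
def spaceDeriv (u : ℝ → ℝ → ℝ) (s : ℝ → ℝ) (x t : ℝ) : ℝ :=
  derivWithin (fun y => u y t) (Icc 0 (s t)) x

/-- The second space derivative `u_xx(x, t)` for `0 < x < s(t)`. -/
def spaceDeriv₂ (u : ℝ → ℝ → ℝ) (x t : ℝ) : ℝ :=
  deriv (fun z => deriv (fun y => u y t) z) x

/-- The lower limit of `u(x, t)` as `(x, t) → (0, 0)` inside `0 ≤ x ≤ s(t)`, `t > 0`. -/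
def liminfAtOrigin (u : ℝ → ℝ → ℝ) (s : ℝ → ℝ) : EReal :=
  liminf (fun p : ℝ × ℝ => ((u p.1 p.2 : ℝ) : EReal)) (𝓝[closedRegion s] ((0 : ℝ), (0 : ℝ)))

/-- The upper limit of `u(x, t)` as `(x, t) → (0, 0)` inside `0 ≤ x ≤ s(t)`, `t > 0`. -/
def limsupAtOrigin (u : ℝ → ℝ → ℝ) (s : ℝ → ℝ) : EReal :=
  limsup (fun p : ℝ × ℝ => ((u p.1 p.2 : ℝ) : EReal)) (𝓝[closedRegion s] ((0 : ℝ), (0 : ℝ)))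

/-- The pair `(u, s)` solves, with all the derivatives involved in existence, the fractional
Stefan problem with flux condition:
`D^α u = lam² u_xx` for `0 < x < s(t)`, `t > 0`; `u_x(0, t) = - q / t^(α/2)`; `u(s(t), t) = C`;
`D^α s(t) = - k u_x(s(t), t)`; `s(0) = 0`; and it has the regularity required of a solution.
The Caputo derivative of `u(x, ·)` has base point `0`, so it uses `u(x, τ)` for all `0 < τ < t`:
the function `u` is given on the whole quadrant `x ≥ 0`, `t > 0`. -/
structure SolvesFluxStefan (α lam k q C : ℝ) (u : ℝ → ℝ → ℝ) (s : ℝ → ℝ) : Prop where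
  -- the region is non-degenerate at every positive time
  s_pos : ∀ t, 0 < t → 0 < s t
  -- the derivatives that occur exist
  u_space_diff : ∀ t, 0 < t → DifferentiableOn ℝ (fun y => u y t) (Icc 0 (s t))
  u_space_diff₂ : ∀ t, 0 < t →
    DifferentiableOn ℝ (fun z => deriv (fun y => u y t) z) (Ioo 0 (s t))
  u_caputo : ∀ t x, 0 < t → 0 < x → x < s t → CaputoDifferentiableAt α (fun τ => u x τ) t
  s_caputo : ∀ t, 0 < t → CaputoDifferentiableAt α s t
  -- the equations
  diffusion : ∀ t x, 0 < t → 0 < x → x < s t →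
    caputoDeriv α (fun τ => u x τ) t = lam ^ 2 * spaceDeriv₂ u x t
  flux : ∀ t, 0 < t → spaceDeriv u s 0 t = -(q / t ^ (α / 2))
  free_boundary : ∀ t, 0 < t → u (s t) t = C
  stefan : ∀ t, 0 < t → caputoDeriv α s t = -k * spaceDeriv u s (s t) t
  s_zero : s 0 = 0
  -- continuity of `u_xx` and `D^α u` in the open region, of `u` and `u_x` up to its sides
  cont_uxx : ContinuousOn (fun p : ℝ × ℝ => spaceDeriv₂ u p.1 p.2) (openRegion s)
  cont_caputo :
    ContinuousOn (fun p : ℝ × ℝ => caputoDeriv α (fun τ => u p.1 τ) p.2) (openRegion s)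
  cont_u : ContinuousOn (fun p : ℝ × ℝ => u p.1 p.2) (closedRegion s)
  cont_ux : ContinuousOn (fun p : ℝ × ℝ => spaceDeriv u s p.1 p.2) (closedRegion s)
  -- `u` stays bounded at the origin
  liminf_gt : ⊥ < liminfAtOrigin u s
  liminf_le : liminfAtOrigin u s ≤ limsupAtOrigin u s
  limsup_lt : limsupAtOrigin u s < ⊤
  -- `s` is continuous on `[0, ∞)`, continuously differentiable on `(0, ∞)`, and
  -- `s'(τ) / (t - τ)^α` is integrable on `(0, t)`
  s_cont : ContinuousOn s (Ici 0)
  s_diff : DifferentiableOn ℝ s (Ioi 0)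
  s_deriv_cont : ContinuousOn (deriv s) (Ioi 0)
  s_integrable : ∀ t, 0 < t → IntegrableOn (fun τ => deriv s τ / (t - τ) ^ α) (Ioo 0 t)

/-- A solution for which, in addition, the lower limit of `u` at the origin is non-negative. -/
structure IsFluxStefanSolution (α lam k q C : ℝ) (u : ℝ → ℝ → ℝ) (s : ℝ → ℝ) : Prop
    extends SolvesFluxStefan α lam k q C u s where
  liminf_nonneg : 0 ≤ liminfAtOrigin u s

/-- `u₂(x, t) = C + q lam Γ(1 - α/2) [W(-x/(lam t^(α/2)), -α/2, 1) - W(-μ, -α/2, 1)]`. -/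
def stefanU (α lam q C μ : ℝ) (x t : ℝ) : ℝ :=
  C + q * lam * Real.Gamma (1 - α / 2) *
    (wrightW (-(x / (lam * t ^ (α / 2)))) (-(α / 2)) 1 - wrightW (-μ) (-(α / 2)) 1)

/-- `s₂(t) = lam μ t^(α/2)`. -/
def stefanS (α lam μ : ℝ) (t : ℝ) : ℝ :=
  lam * μ * t ^ (α / 2)

end

noncomputable section

/-! Put `ν = α / 2`, so `0 < ν < 1 / 2`, and let `Φ_b(z) = W(-z, -ν, b)` and `V_b(x, t) = t^(b-1)
Φ_b(x t^(-ν))`. Everything rests on three shift rules: `Φ_b' = -Φ_{b-ν}`, `∂_t V_b = V_{b-1}`, and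
the fractional integral of order `β` in time takes `V_b` to `V_{b+β}`. Up to constants `u₂` is
`V_1(x / lam, t)`. Its time derivative `V_0`, integrated to order `1 - 2ν`, is `V_{1-2ν}`, and two
space derivatives give a multiple of the same function; this is the diffusion equation. The
conditions at the two ends follow by substitution, and the Stefan condition becomes the equation for
`μ`.

The series gives the first two rules. The third (`integral_rpow_mul_wrightV`) comes from writing
`V_b` as a Bromwich integral of `exp (t ζ) ζ^(-b) exp (-x ζ^ν)`. Its contour can be moved between
the cut and the imaginary axis because `cos (ν π) > 0`, that is `ν < 1 / 2`. On the imaginary axis a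
time shift is multiplication by an exponential, so convolution with `σ^(β-1)` multiplies the
integrand by `Γ(β) ζ^(-β)`.

Uniqueness of the root and boundedness of `u₂` need signs. A negative minimum of `M_ν = Φ_{1-ν}` is
excluded by an extremum principle for the Caputo derivative (`wrightPhi_one_sub_nonneg`). Then
`Φ_0(z) = ν z M_ν(z) ≥ 0`, hence its fractional integral `Φ_{1-2ν}` is nonnegative, so `M_ν` and
`Φ_1` decrease. Thus `μ = K M_ν(μ)` has exactly one solution, and `u₂ ≥ C` in the region. -/

/-! ### Gamma integrals in the coordinate `r = exp u`. -/

theorem Real.exp_mul_sub_eq_rpow (s c u : ℝ) :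
    Real.exp (s * u - c * Real.exp u) =
      |Real.exp u| • (Real.exp u ^ (s - 1) * Real.exp (-(c * Real.exp u))) := by
  rw [abs_of_pos (Real.exp_pos u), ← Real.exp_mul, smul_eq_mul, ← Real.exp_add, ← Real.exp_add]
  congr 1; ring

theorem integrable_exp_mul_sub_exp {s c : ℝ} (hs : 0 < s) (hc : 0 < c) :
    Integrable fun u : ℝ => Real.exp (s * u - c * Real.exp u) := by
  have h := (integrableOn_image_iff_integrableOn_abs_deriv_smul (s := univ) MeasurableSet.univ
    (fun x _ => (Real.hasDerivAt_exp x).hasDerivWithinAt) Real.exp_injective.injOn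
    (fun r : ℝ => r ^ (s - 1) * Real.exp (-(c * r)))).1 (by
      rw [image_univ, Real.range_exp]
      simpa using integrableOn_rpow_mul_exp_neg_mul_rpow (p := 1) (s := s - 1) (b := c)
        (by linarith) one_pos hc)
  rw [integrableOn_univ] at h
  exact h.congr (Eventually.of_forall fun u => (Real.exp_mul_sub_eq_rpow s c u).symm)

theorem integral_exp_mul_sub_exp {s c : ℝ} (hs : 0 < s) (hc : 0 < c) :
    ∫ u : ℝ, Real.exp (s * u - c * Real.exp u) = Real.Gamma s * c ^ (-s) := by
  have h := integral_image_eq_integral_abs_deriv_smul (s := univ) MeasurableSet.univ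
    (fun x _ => (Real.hasDerivAt_exp x).hasDerivWithinAt) Real.exp_injective.injOn
    (fun r : ℝ => r ^ (s - 1) * Real.exp (-(c * r)))
  rw [image_univ, Real.range_exp, Real.integral_rpow_mul_exp_neg_mul_Ioi hs hc,
    Measure.restrict_univ] at h
  simp_rw [Real.exp_mul_sub_eq_rpow s c, ← h]
  rw [one_div, Real.inv_rpow hc.le, Real.rpow_neg hc.le, mul_comm]

theorem integrable_exp_mul_sub_exp_mul {s c p : ℝ} (hs : 0 < s) (hc : 0 < c) (hp : 0 < p) :
    Integrable fun u : ℝ => Real.exp (s * u - c * Real.exp (p * u)) := by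
  have h := (integrable_exp_mul_sub_exp (div_pos hs hp) hc).comp_mul_left' hp.ne'
  refine h.congr (Eventually.of_forall fun u => ?_)
  have : s / p * (p * u) = s * u := by field_simp
  simp only [this]

theorem tendsto_exp_mul_sub_exp_mul_atTop {s c p : ℝ} (hc : 0 < c) (hp : 0 < p) :
    Tendsto (fun u : ℝ => Real.exp (s * u - c * Real.exp (p * u))) atTop (𝓝 0) := by
  have h := (tendsto_rpow_mul_exp_neg_mul_atTop_nhds_zero (s / p) c hc).comp
    (Real.tendsto_exp_atTop.comp (tendsto_id.const_mul_atTop hp))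
  refine h.congr fun u => ?_
  have : p * u * (s / p) = s * u := by field_simp
  simp only [Function.comp, id, ← Real.exp_mul, this, ← Real.exp_add]
  congr 1; ring

theorem tendsto_exp_mul_sub_exp_mul_atBot {s c p : ℝ} (hs : 0 < s) (hc : 0 < c) :
    Tendsto (fun u : ℝ => Real.exp (s * u - c * Real.exp (p * u))) atBot (𝓝 0) := by
  have h : Tendsto (fun u : ℝ => Real.exp (s * u)) atBot (𝓝 0) :=
    Real.tendsto_exp_atBot.comp (tendsto_id.const_mul_atBot hs)
  refine squeeze_zero (fun u => (Real.exp_pos _).le) (fun u => Real.exp_le_exp.2 ?_) h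
  have := Real.exp_pos (p * u)
  nlinarith

theorem exists_rpow_le_mul_add {ν δ : ℝ} (hν₀ : 0 ≤ ν) (hν₁ : ν < 1) (hδ : 0 < δ) :
    ∃ K : ℝ, ∀ r : ℝ, 0 < r → r ^ ν ≤ δ * r + K := by
  have h := tendsto_rpow_neg_atTop (y := 1 - ν) (by linarith)
  obtain ⟨R, hR, hR0⟩ := ((h.eventually (gt_mem_nhds hδ)).and (eventually_gt_atTop 0)).exists
  refine ⟨R ^ ν, fun r hr => ?_⟩
  rcases le_total r R with h1 | h1
  · have := Real.rpow_le_rpow hr.le h1 hν₀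
    nlinarith
  · have h2 : r ^ ν = r ^ (-(1 - ν)) * r := by
      rw [← Real.rpow_add_one hr.ne']; congr 1; ring
    have h3 : r ^ (-(1 - ν)) ≤ R ^ (-(1 - ν)) :=
      Real.rpow_le_rpow_of_nonpos hR0 h1 (by linarith)
    have h4 : 0 ≤ R ^ ν := Real.rpow_nonneg hR0.le _
    rw [h2]
    nlinarith

theorem integrable_exp_mul_sub_exp_add_exp {s c ν d : ℝ} (hs : 0 < s) (hc : 0 < c) (hν₀ : 0 ≤ ν)
    (hν₁ : ν < 1) (hd : 0 ≤ d) :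
    Integrable fun u : ℝ => Real.exp (s * u - c * Real.exp u + d * Real.exp (ν * u)) := by
  -- With this `δ` one has `d * δ ≤ c / 2`, so half of the decay `-c exp u` absorbs `d exp (ν u)`;
  -- the `+ 1` covers `d = 0`.
  obtain ⟨K, hK⟩ := exists_rpow_le_mul_add hν₀ hν₁ (δ := c / (2 * (d + 1))) (by positivity)
  refine ((integrable_exp_mul_sub_exp hs (half_pos hc)).mul_const (Real.exp (d * K))).mono'
    (by fun_prop) (Eventually.of_forall fun u => ?_)
  rw [Real.norm_eq_abs, abs_of_pos (Real.exp_pos _), ← Real.exp_add, Real.exp_le_exp]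
  have h1 := hK _ (Real.exp_pos u)
  rw [← Real.exp_mul, mul_comm u] at h1
  have h2 : d * (c / (2 * (d + 1))) ≤ c / 2 := by
    rw [mul_div_assoc', div_le_div_iff₀ (by positivity) two_pos]; nlinarith
  have h3 := mul_le_mul_of_nonneg_left h1 hd
  have h4 := mul_le_mul_of_nonneg_right h2 (Real.exp_pos u).le
  nlinarith

/-! ### The reciprocal Gamma function and the Wright kernel. -/

/-- The reflection formula, valid also at the poles: there the sine vanishes and `Real.Gamma` is `0`
by convention. -/
theorem Real.inv_Gamma_eq_Gamma_one_sub_mul_sin {s : ℝ} (hs : s < 1) :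
    (Real.Gamma s)⁻¹ = Real.Gamma (1 - s) * Real.sin (Real.pi * (1 - s)) / Real.pi := by
  have h := Real.Gamma_mul_Gamma_one_sub s
  have hsin : Real.sin (Real.pi * (1 - s)) = Real.sin (Real.pi * s) := by
    rw [mul_sub, mul_one, Real.sin_pi_sub]
  have hG := Real.Gamma_pos_of_pos (sub_pos.2 hs)
  rw [hsin]
  by_cases h0 : Real.sin (Real.pi * s) = 0
  · rw [h0, div_zero, mul_eq_zero] at h
    rw [h.resolve_right hG.ne', h0]; simp
  · have : Real.Gamma s ≠ 0 := by
      intro h1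
      rw [h1, zero_mul, eq_comm, div_eq_zero_iff] at h
      exact h.elim Real.pi_ne_zero h0
    rw [eq_div_iff h0] at h
    rw [inv_eq_one_div, div_eq_div_iff this Real.pi_ne_zero]
    linarith

theorem Real.mul_inv_Gamma_add_one (s : ℝ) :
    s * (Real.Gamma (s + 1))⁻¹ = (Real.Gamma s)⁻¹ := by
  by_cases hs : s = 0
  · simp [hs, Real.Gamma_zero]
  · rw [Real.Gamma_add_one hs, mul_inv, ← mul_assoc, mul_inv_cancel₀ hs, one_mul]

/-- `Φ_b(z) = W(-z, -ν, b)`. -/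
def wrightPhi (ν b z : ℝ) : ℝ :=
  wrightW (-z) (-ν) b

/-- `V_b(x, t) = t^(b-1) Φ_b(x t^(-ν))`, whose Laplace transform in `t` is `p^(-b) exp (-x p^ν)`. -/
def wrightV (ν b x t : ℝ) : ℝ :=
  t ^ (b - 1) * wrightPhi ν b (x * t ^ (-ν))

/-- The integrand `exp (t ζ) ζ^(-b) exp (-x ζ^ν) dζ` in the coordinate `ζ = exp w`. -/
def wrightKernel (ν b x t : ℝ) (w : ℂ) : ℂ :=
  Complex.exp (t * Complex.exp w + (1 - b) * w - x * Complex.exp (ν * w))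

theorem hasSum_pow_div_factorial_real (x : ℝ) :
    HasSum (fun n : ℕ => x ^ n / n.factorial) (Real.exp x) := by
  rw [Real.exp_eq_exp_ℝ]; exact NormedSpace.expSeries_div_hasSum_exp x

theorem hasSum_pow_div_factorial_complex (x : ℂ) :
    HasSum (fun n : ℕ => x ^ n / n.factorial) (Complex.exp x) := by
  rw [Complex.exp_eq_exp_ℂ]; exact NormedSpace.expSeries_div_hasSum_exp x

theorem integral_gamma_term {ν b t : ℝ} (hν₀ : 0 < ν) (hb : b < 1) (ht : 0 < t) (n : ℕ) :
    ∫ u : ℝ, Real.exp ((1 - b + ν * n) * u - t * Real.exp u) =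
      Real.Gamma (1 - b + ν * n) * t ^ (-(1 - b + ν * n)) :=
  integral_exp_mul_sub_exp (by have := sub_pos.2 hb; positivity) ht

theorem integrable_gamma_term {ν b t : ℝ} (hν₀ : 0 < ν) (hb : b < 1) (ht : 0 < t) (n : ℕ) :
    Integrable fun u : ℝ => Real.exp ((1 - b + ν * n) * u - t * Real.exp u) :=
  integrable_exp_mul_sub_exp (by have := sub_pos.2 hb; positivity) ht

/-- Each term is the integral of one term of the expansion of `exp (R exp (ν u))`, so the partial
sums stay below the integral of the full exponential. -/
theorem summable_pow_mul_Gamma {ν b t R : ℝ} (hν₀ : 0 < ν) (hν₁ : ν < 1) (hb : b < 1)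
    (ht : 0 < t) (hR : 0 ≤ R) :
    Summable fun n : ℕ =>
      R ^ n / n.factorial * (Real.Gamma (1 - b + ν * n) * t ^ (-(1 - b + ν * n))) := by
  have hb' := sub_pos.2 hb
  refine summable_of_sum_le (c := ∫ u : ℝ, Real.exp ((1 - b) * u - t * Real.exp u +
    R * Real.exp (ν * u))) (fun n => ?_) fun s => ?_
  · have := Real.Gamma_pos_of_pos (s := 1 - b + ν * n) (by positivity)
    simp only [Pi.zero_apply]
    positivity
  · simp_rw [← integral_gamma_term hν₀ hb ht, ← integral_const_mul]
    rw [← integral_finsetSum _ fun n _ => (integrable_gamma_term hν₀ hb ht n).const_mul _]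
    refine integral_mono (integrable_finsetSum _
      fun n _ => (integrable_gamma_term hν₀ hb ht n).const_mul _)
      (integrable_exp_mul_sub_exp_add_exp hb' ht hν₀.le hν₁ hR) fun u => ?_
    have h : ∀ n : ℕ, R ^ n / n.factorial * Real.exp ((1 - b + ν * n) * u - t * Real.exp u) =
        Real.exp ((1 - b) * u - t * Real.exp u) *
          ((R * Real.exp (ν * u)) ^ n / n.factorial) := fun n => by
      rw [mul_pow, ← Real.exp_nat_mul, show (1 - b + ν * n) * u - t * Real.exp u =
        ((1 - b) * u - t * Real.exp u) + n * (ν * u) by ring, Real.exp_add]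
      ring
    simp only [h, ← Finset.mul_sum]
    rw [Real.exp_add ((1 - b) * u - t * Real.exp u)]
    exact mul_le_mul_of_nonneg_left
      (sum_le_hasSum _ (fun n _ => by positivity) (hasSum_pow_div_factorial_real _))
      (Real.exp_pos _).le

theorem inv_Gamma_neg_mul_add {ν b : ℝ} (hν₀ : 0 < ν) (hb : b < 1) (n : ℕ) :
    (Real.Gamma (-ν * n + b))⁻¹ = Real.Gamma (1 - b + ν * n) *
      Real.sin ((1 - b + ν * n) * Real.pi) / Real.pi := by
  have hn : 0 ≤ ν * n := by positivity
  rw [Real.inv_Gamma_eq_Gamma_one_sub_mul_sin (by linarith)]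
  rw [show 1 - (-ν * n + b) = 1 - b + ν * n by ring, mul_comm Real.pi]

/-- On the upper lip of the cut, `arg ζ = π`, expand `exp (-x ζ^ν)` and integrate termwise. The
`n`-th term is a Gamma value times a phase; its imaginary part is a sine, which reflection turns
into `π / Γ(b - ν n)`. -/
theorem im_integral_wrightKernel_pi {ν b t : ℝ} (hν₀ : 0 < ν) (hν₁ : ν < 1) (hb : b < 1)
    (ht : 0 < t) (x : ℝ) :
    (∫ u : ℝ, wrightKernel ν b x t (u + Real.pi * Complex.I)).im = Real.pi * wrightV ν b x t := by
  set c : ℕ → ℂ := fun n => ((-x) ^ n / n.factorial : ℝ) *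
    Complex.exp (((1 - b + ν * n) * Real.pi : ℝ) * Complex.I) with hc
  set F : ℕ → ℝ → ℂ := fun n u =>
    (Real.exp ((1 - b + ν * n) * u - t * Real.exp u) : ℝ) * c n with hF
  have hcn : ∀ n, ‖c n‖ = |x| ^ n / n.factorial := fun n => by
    simp only [hc, norm_mul, Complex.norm_exp_ofReal_mul_I, mul_one, Complex.norm_real]
    simp
  have hint : ∀ n, Integrable (F n) := fun n =>
    ((integrable_gamma_term hν₀ hb ht n).ofReal).mul_const _
  have hnorm : ∀ n, ∫ u, ‖F n u‖ = |x| ^ n / n.factorial *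
      (Real.Gamma (1 - b + ν * n) * t ^ (-(1 - b + ν * n))) := fun n => by
    rw [← integral_gamma_term hν₀ hb ht, ← integral_const_mul]
    refine integral_congr_ae (Eventually.of_forall fun u => ?_)
    simp only [hF, norm_mul, hcn, Complex.norm_real, Real.norm_eq_abs, abs_of_pos (Real.exp_pos _)]
    ring
  have hsum := hasSum_integral_of_summable_integral_norm hint (by
    simp_rw [hnorm]; exact summable_pow_mul_Gamma hν₀ hν₁ hb ht (abs_nonneg x))
  have htsum : ∀ u : ℝ, ∑' n, F n u = wrightKernel ν b x t (u + Real.pi * Complex.I) := fun u => by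
    have h1 := (hasSum_pow_div_factorial_complex
      (-x * Complex.exp (ν * (u + Real.pi * Complex.I)))).mul_left
      (Complex.exp (t * Complex.exp (u + Real.pi * Complex.I) + (1 - b) * (u + Real.pi * Complex.I)))
    rw [← Complex.exp_add] at h1
    rw [wrightKernel, sub_eq_add_neg (_ + _), ← neg_mul (x : ℂ), ← h1.tsum_eq]
    refine tsum_congr fun n => ?_
    simp only [hF, hc]
    rw [mul_pow, ← Complex.exp_nat_mul]
    push_cast
    rw [mul_left_comm, ← Complex.exp_add, mul_div_right_comm _ _ (n.factorial : ℂ), mul_left_comm,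
      ← Complex.exp_add, Complex.exp_add (u : ℂ), Complex.exp_pi_mul_I]
    congr 2
    ring
  simp_rw [htsum] at hsum
  have him := Complex.hasSum_im hsum
  rw [← him.tsum_eq, wrightV, wrightPhi, wrightW, ← tsum_mul_left, ← tsum_mul_left]
  refine tsum_congr fun n => ?_
  rw [integral_mul_const, integral_complex_ofReal, integral_gamma_term hν₀ hb ht, hc]
  simp only
  rw [← mul_assoc, ← Complex.ofReal_mul, Complex.im_ofReal_mul, Complex.exp_ofReal_mul_I_im,
    div_mul_eq_div_div, div_eq_mul_inv (_ / _), inv_Gamma_neg_mul_add hν₀ hb, neg_pow (x * _),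
    mul_pow, ← Real.rpow_mul_natCast ht.le, neg_pow x,
    show -(1 - b + ν * n) = (b - 1) + -ν * n by ring, Real.rpow_add ht]
  field_simp

/-! ### Convergence of the Wright series and its shift rules. -/

theorem summable_wright_of_lt_one {ν b : ℝ} (hν₀ : 0 < ν) (hν₁ : ν < 1) (hb : b < 1) {R : ℝ}
    (hR : 0 ≤ R) :
    Summable fun n : ℕ => R ^ n / n.factorial * |(Real.Gamma (-ν * n + b))⁻¹| := by
  refine (summable_pow_mul_Gamma hν₀ hν₁ hb one_pos hR).of_nonneg_of_le (fun n => by positivity)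
    fun n => mul_le_mul_of_nonneg_left ?_ (by positivity)
  have hb' := sub_pos.2 hb
  have hG := Real.Gamma_pos_of_pos (s := 1 - b + ν * n) (by positivity)
  rw [Real.one_rpow, mul_one, inv_Gamma_neg_mul_add hν₀ hb, abs_div, abs_mul, abs_of_pos hG,
    abs_of_pos Real.pi_pos, div_le_iff₀ Real.pi_pos]
  refine mul_le_mul_of_nonneg_left ?_ hG.le
  exact (Real.abs_sin_le_one _).trans (by linarith [Real.pi_gt_three])

theorem summable_wright {ν b : ℝ} (hν₀ : 0 < ν) (hν₁ : ν < 1) (hb : b ≤ 1) {R : ℝ}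
    (hR : 0 ≤ R) :
    Summable fun n : ℕ => R ^ n / n.factorial * |(Real.Gamma (-ν * n + b))⁻¹| := by
  rcases hb.lt_or_eq with hb | rfl
  · exact summable_wright_of_lt_one hν₀ hν₁ hb hR
  -- For `n ≥ 1`, `-ν n / Γ(1 - ν n) = 1 / Γ(-ν n)` bounds the case `b = 1` by the case `b = 0`; the
  -- term `n = 0` has to be dropped.
  rw [← summable_nat_add_iff 1]
  have h := (summable_nat_add_iff 1).2
    ((summable_wright_of_lt_one hν₀ hν₁ zero_lt_one hR).mul_left ν⁻¹)
  refine h.of_nonneg_of_le (fun n => by positivity) fun n => ?_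
  rw [mul_left_comm]
  refine mul_le_mul_of_nonneg_left ?_ (by positivity)
  have hn : (0 : ℝ) ≤ n := by positivity
  rw [← Real.mul_inv_Gamma_add_one (-ν * (n + 1 : ℕ) + 0), add_zero, abs_mul, ← mul_assoc]
  refine le_mul_of_one_le_left (abs_nonneg _) ?_
  rw [abs_mul, abs_neg, abs_of_pos hν₀, inv_mul_cancel_left₀ hν₀.ne', abs_of_nonneg (by positivity)]
  push_cast
  linarith

theorem hasSum_wrightPhi {ν b : ℝ} (hν₀ : 0 < ν) (hν₁ : ν < 1) (hb : b ≤ 1) (z : ℝ) :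
    HasSum (fun n : ℕ => (-z) ^ n / n.factorial * (Real.Gamma (-ν * n + b))⁻¹)
      (wrightPhi ν b z) := by
  have h : Summable fun n : ℕ => (-z) ^ n / n.factorial * (Real.Gamma (-ν * n + b))⁻¹ := by
    refine .of_norm ((summable_wright hν₀ hν₁ hb (abs_nonneg z)).congr fun n => ?_)
    simp
  convert h.hasSum using 1
  exact tsum_congr fun n => by rw [div_mul_eq_div_div, div_eq_mul_inv _ (Real.Gamma _)]

theorem hasDerivAt_wrightPhi {ν b : ℝ} (hν₀ : 0 < ν) (hν₁ : ν < 1) (hb : b ≤ 1) (z : ℝ) :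
    HasDerivAt (wrightPhi ν b) (-wrightPhi ν (b - ν) z) z := by
  set R := |z| + 1 with hR
  have hR0 : 0 ≤ R := by positivity
  have hcoef : ∀ n : ℕ, -ν * ((n + 1 : ℕ) : ℝ) + b = -ν * n + (b - ν) := fun n => by
    push_cast; ring
  have hfac : ∀ (n : ℕ) (y : ℝ), ((n + 1 : ℕ) : ℝ) * y ^ n / (n + 1).factorial =
      y ^ n / n.factorial := fun n y => by
    rw [Nat.factorial_succ, Nat.cast_mul]; field_simp
  have hu : Summable fun n : ℕ =>
      (n * R ^ (n - 1) / n.factorial) * |(Real.Gamma (-ν * n + b))⁻¹| := by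
    rw [← summable_nat_add_iff 1]
    refine (summable_wright hν₀ hν₁ (b := b - ν) (by linarith) hR0).congr fun n => ?_
    rw [hcoef, Nat.add_sub_cancel, hfac]
  have h := hasDerivAt_tsum_of_isPreconnected (t := Metric.ball (0 : ℝ) R)
    (g := fun (n : ℕ) (y : ℝ) => (-y) ^ n / n.factorial * (Real.Gamma (-ν * n + b))⁻¹)
    (g' := fun (n : ℕ) (y : ℝ) => -(n * (-y) ^ (n - 1) / n.factorial) * (Real.Gamma (-ν * n + b))⁻¹)
    (y₀ := z) (y := z) hu Metric.isOpen_ball (convex_ball _ _).isPreconnected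
    (fun n y _ => ((((hasDerivAt_neg' y).fun_pow n).div_const _).mul_const _).congr_deriv (by ring))
    (fun n y hy => by
      rw [mem_ball_zero_iff, Real.norm_eq_abs] at hy
      simp only [norm_mul, norm_neg, norm_div, norm_pow, Real.norm_eq_abs, Nat.abs_cast]
      gcongr)
    (by simp [hR]) (hasSum_wrightPhi hν₀ hν₁ hb z).summable (by simp [hR])
  have h1 : HasSum (fun n : ℕ => -(n * (-z) ^ (n - 1) / n.factorial) *
      (Real.Gamma (-ν * n + b))⁻¹) (-wrightPhi ν (b - ν) z) := by
    rw [← hasSum_nat_add_iff' 1]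
    simp only [Finset.sum_range_one, Nat.cast_zero, zero_mul, zero_div, neg_zero, sub_zero]
    refine (hasSum_wrightPhi hν₀ hν₁ (b := b - ν) (by linarith) z).neg.congr_fun fun n => ?_
    rw [hcoef, Nat.add_sub_cancel, hfac, neg_mul]
  rw [h1.tsum_eq] at h
  refine h.congr_of_eventuallyEq (Eventually.of_forall fun y => ?_)
  exact (hasSum_wrightPhi hν₀ hν₁ hb y).tsum_eq.symm

theorem continuous_wrightPhi {ν b : ℝ} (hν₀ : 0 < ν) (hν₁ : ν < 1) (hb : b ≤ 1) :
    Continuous (wrightPhi ν b) :=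
  continuous_iff_continuousAt.2 fun z => (hasDerivAt_wrightPhi hν₀ hν₁ hb z).continuousAt

theorem wrightPhi_zero (ν b : ℝ) : wrightPhi ν b 0 = (Real.Gamma b)⁻¹ := by
  rw [wrightPhi, wrightW, tsum_eq_single 0 fun n hn => by simp [hn]]
  simp

/-- Termwise `(b - 1 - ν n) / Γ(b - ν n) = 1 / Γ(b - 1 - ν n)`; the factor `n` produces the term
with index `b - ν`. It makes the time derivative of `V_b` collapse to `V_{b-1}`. -/
theorem wrightPhi_sub_one {ν b : ℝ} (hν₀ : 0 < ν) (hν₁ : ν < 1) (hb : b ≤ 1) (z : ℝ) :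
    (b - 1) * wrightPhi ν b z + ν * z * wrightPhi ν (b - ν) z = wrightPhi ν (b - 1) z := by
  have h1 : HasSum (fun n : ℕ => (-ν * n) * ((-z) ^ n / n.factorial *
      (Real.Gamma (-ν * n + b))⁻¹)) (ν * z * wrightPhi ν (b - ν) z) := by
    rw [← hasSum_nat_add_iff' 1]
    simp only [Finset.sum_range_one, Nat.cast_zero, mul_zero, zero_mul, sub_zero]
    refine ((hasSum_wrightPhi hν₀ hν₁ (b := b - ν) (by linarith) z).mul_left (ν * z)).congr_fun
      fun n => ?_
    rw [show -ν * ((n + 1 : ℕ) : ℝ) + b = -ν * n + (b - ν) by push_cast; ring,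
      Nat.factorial_succ, Nat.cast_mul]
    field_simp
    ring
  have h2 := ((hasSum_wrightPhi hν₀ hν₁ hb z).mul_left (b - 1)).add h1
  refine h2.unique ((hasSum_wrightPhi hν₀ hν₁ (b := b - 1) (by linarith) z).congr_fun fun n => ?_)
  rw [← Real.mul_inv_Gamma_add_one (-ν * n + (b - 1)),
    show -ν * n + (b - 1) + 1 = -ν * n + b by ring]
  ring

theorem hasDerivAt_wrightV {ν b : ℝ} (hν₀ : 0 < ν) (hν₁ : ν < 1) (hb : b ≤ 1) (x : ℝ) {t : ℝ}
    (ht : 0 < t) : HasDerivAt (wrightV ν b x) (wrightV ν (b - 1) x t) t := by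
  have h1 : HasDerivAt (fun t : ℝ => x * t ^ (-ν)) (x * (-ν * t ^ (-ν - 1))) t :=
    (Real.hasDerivAt_rpow_const (Or.inl ht.ne')).const_mul x
  have h2 := (Real.hasDerivAt_rpow_const (p := b - 1) (Or.inl ht.ne')).mul
    ((hasDerivAt_wrightPhi hν₀ hν₁ hb (x * t ^ (-ν))).comp t h1)
  refine h2.congr_deriv ?_
  rw [wrightV, ← wrightPhi_sub_one hν₀ hν₁ hb, Real.rpow_sub_one ht.ne' (b - 1),
    Real.rpow_sub_one ht.ne' (-ν)]
  simp only [Function.comp]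
  ring

/-! ### Contour shifts and the integral along the imaginary axis. -/

/-- The integral of a holomorphic function along the horizontal lines of a strip in which it is
dominated by an integrable function vanishing at infinity does not depend on the line. -/
theorem integral_horizontal_line_eq {f : ℂ → ℂ} (hf : Differentiable ℂ f) {B : ℝ → ℝ} {θ₁ θ₂ : ℝ}
    (hB : Integrable B) (hB_top : Tendsto B atTop (𝓝 0)) (hB_bot : Tendsto B atBot (𝓝 0))
    (hfB : ∀ u : ℝ, ∀ θ ∈ uIcc θ₁ θ₂, ‖f (u + θ * Complex.I)‖ ≤ B u) :
    ∫ u : ℝ, f (u + θ₁ * Complex.I) = ∫ u : ℝ, f (u + θ₂ * Complex.I) := by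
  have hint : ∀ θ ∈ uIcc θ₁ θ₂, Integrable fun u : ℝ => f (u + θ * Complex.I) := fun θ hθ =>
    hB.mono' (hf.continuous.comp (by fun_prop)).aestronglyMeasurable
      (Eventually.of_forall fun u => hfB u θ hθ)
  have hlim : ∀ θ ∈ uIcc θ₁ θ₂, Tendsto (fun R : ℝ => ∫ u in (-R)..R, f (u + θ * Complex.I)) atTop
      (𝓝 (∫ u : ℝ, f (u + θ * Complex.I))) := fun θ hθ =>
    intervalIntegral_tendsto_integral (hint θ hθ) tendsto_neg_atTop_atBot tendsto_id
  have hside : ∀ {g : ℝ → ℝ}, Tendsto (fun R => B (g R)) atTop (𝓝 0) → Tendsto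
      (fun R : ℝ => Complex.I • ∫ y in θ₁..θ₂, f (g R + y * Complex.I)) atTop (𝓝 0) := by
    intro g hg
    refine squeeze_zero_norm (a := fun R => B (g R) * |θ₂ - θ₁|) (fun R => ?_)
      (by simpa using hg.mul_const |θ₂ - θ₁|)
    rw [norm_smul, Complex.norm_I, one_mul]
    exact intervalIntegral.norm_integral_le_of_norm_le_const fun y hy =>
      hfB _ _ (uIoc_subset_uIcc hy)
  have hzero : ∀ R : ℝ, (∫ u in (-R)..R, f (u + θ₁ * Complex.I)) -
      (∫ u in (-R)..R, f (u + θ₂ * Complex.I)) +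
      (Complex.I • ∫ y in θ₁..θ₂, f (R + y * Complex.I)) -
      (Complex.I • ∫ y in θ₁..θ₂, f ((-R : ℝ) + y * Complex.I)) = 0 := fun R => by
    have := Complex.integral_boundary_rect_eq_zero_of_differentiableOn f ⟨-R, θ₁⟩ ⟨R, θ₂⟩
      hf.differentiableOn
    simpa using this
  have h := ((((hlim θ₁ left_mem_uIcc).sub (hlim θ₂ right_mem_uIcc)).add
    (hside (g := fun R => R) hB_top)).sub
    (hside (g := fun R => -R) (hB_bot.comp tendsto_neg_atTop_atBot)))
  simp only [hzero, add_zero, sub_zero] at h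
  exact sub_eq_zero.1 (tendsto_nhds_unique h tendsto_const_nhds)

/-- Euler's integral on a rotated ray: between the angles `0` and `φ` the real part of `ζ = exp w`
is at least `cos φ * |ζ|`, which is enough decay to rotate back. -/
theorem integral_cexp_mul_sub_cexp {β φ : ℝ} (hβ : 0 < β) (hφ : |φ| < Real.pi / 2) :
    ∫ v : ℝ, Complex.exp (β * (v + φ * Complex.I) - Complex.exp (v + φ * Complex.I)) =
      Real.Gamma β := by
  have hc : 0 < Real.cos φ := Real.cos_pos_of_mem_Ioo (abs_lt.1 hφ)
  have hf : Differentiable ℂ fun w : ℂ => Complex.exp (β * w - Complex.exp w) := by fun_prop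
  rw [integral_horizontal_line_eq hf (θ₁ := φ) (θ₂ := 0)
    (integrable_exp_mul_sub_exp_mul hβ hc one_pos)
    (tendsto_exp_mul_sub_exp_mul_atTop hc one_pos) (tendsto_exp_mul_sub_exp_mul_atBot hβ hc)]
  · have h := integral_exp_mul_sub_exp hβ one_pos
    rw [Real.one_rpow, mul_one] at h
    rw [← h, ← integral_complex_ofReal]
    refine integral_congr_ae (Eventually.of_forall fun v => ?_)
    simp
  · intro u θ hθ
    rw [Complex.norm_exp, Real.exp_le_exp]
    simp only [Complex.sub_re, Complex.re_ofReal_mul, Complex.add_re, Complex.ofReal_re,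
      Complex.mul_I_re, Complex.ofReal_im, Complex.exp_re, Complex.add_im, Complex.mul_I_im,
      neg_zero, add_zero, zero_add, one_mul]
    have hle : |θ| ≤ |φ| := by
      rcases le_total φ 0 with h | h
      · rw [uIcc_of_le h] at hθ
        rw [abs_of_nonpos hθ.2, abs_of_nonpos h]; linarith [hθ.1]
      · rw [uIcc_of_ge h] at hθ
        rw [abs_of_nonneg hθ.1, abs_of_nonneg h]; exact hθ.2
    have hcos : Real.cos φ ≤ Real.cos θ := by
      rw [← Real.cos_abs φ, ← Real.cos_abs θ]
      exact Real.cos_le_cos_of_nonneg_of_le_pi (abs_nonneg _) (by linarith [Real.pi_pos]) hle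
    nlinarith [Real.exp_pos u]

theorem integral_rpow_mul_cexp_neg_mul {β : ℝ} (hβ : 0 < β) {p : ℂ} (hp : 0 < p.re) :
    ∫ σ : ℝ in Ioi 0, ((σ ^ (β - 1) : ℝ) : ℂ) * Complex.exp (-p * σ) =
      Real.Gamma β * Complex.exp (-β * Complex.log p) := by
  have hp0 : p ≠ 0 := fun h => by simp [h] at hp
  have h := integral_image_eq_integral_abs_deriv_smul (s := univ) MeasurableSet.univ
    (fun x _ => (Real.hasDerivAt_exp x).hasDerivWithinAt) Real.exp_injective.injOn
    (fun σ : ℝ => ((σ ^ (β - 1) : ℝ) : ℂ) * Complex.exp (-p * σ))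
  rw [image_univ, Real.range_exp, Measure.restrict_univ] at h
  -- Multiplication of `σ` by `p` is, in the exponential coordinate, the real translation by `log
  -- ‖p‖` followed by the shift to height `arg p`.
  rw [h, ← integral_cexp_mul_sub_cexp hβ (Complex.abs_arg_lt_pi_div_two_iff.2 (Or.inl hp)),
    ← integral_sub_right_eq_self _ (Real.log ‖p‖), ← integral_mul_const]
  refine integral_congr_ae (Eventually.of_forall fun v => ?_)
  have hpe : Complex.exp (v + p.arg * Complex.I) =
      Complex.exp (v - Real.log ‖p‖) * p := by
    have hlog : Complex.exp (Real.log ‖p‖ + p.arg * Complex.I) = p := Complex.exp_log hp0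
    calc _ = Complex.exp (v - Real.log ‖p‖) * Complex.exp (Real.log ‖p‖ + p.arg * Complex.I) := by
          rw [← Complex.exp_add]; congr 1; ring
      _ = _ := by rw [hlog]
  simp only [hpe]
  rw [abs_of_pos (Real.exp_pos _), ← Real.exp_mul, Complex.real_smul, ← mul_assoc,
    ← Complex.ofReal_mul, ← Real.exp_add, ← Complex.exp_add, Complex.ofReal_exp, ← Complex.exp_add,
    Complex.log]
  congr 1
  push_cast
  ring

/-- Where `t cos θ ≤ 0` the factor `exp (t ζ)` has norm at most `1`, and `cos (ν θ) ≥ cos (ν π)`.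
The bound depends on neither `t` nor `θ`, so it serves both for moving lines and for dominated
convergence. -/
theorem norm_wrightKernel_le {ν : ℝ} (hν₀ : 0 < ν) (hν₁ : ν < 1 / 2) (b : ℝ) {x t θ : ℝ}
    (hx : 0 ≤ x) (hθ₀ : 0 ≤ θ) (hθ₁ : θ ≤ Real.pi) (ht : t * Real.cos θ ≤ 0) (u : ℝ) :
    ‖wrightKernel ν b x t (u + θ * Complex.I)‖ ≤
      Real.exp ((1 - b) * u - x * Real.cos (ν * Real.pi) * Real.exp (ν * u)) := by
  rw [wrightKernel, Complex.norm_exp, Real.exp_le_exp]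
  have h1 : ((1 - b : ℂ) * (u + θ * Complex.I)).re = (1 - b) * u := by simp
  have h2 : (ν : ℂ) * (u + θ * Complex.I) = (ν * u : ℝ) + (ν * θ : ℝ) * Complex.I := by
    push_cast; ring
  simp only [Complex.sub_re, Complex.add_re, h1, h2, Complex.re_ofReal_mul,
    Complex.ofReal_re, Complex.mul_I_re, Complex.ofReal_im, Complex.exp_re, Complex.add_im,
    Complex.mul_I_im, neg_zero, add_zero, zero_add]
  have hcos : Real.cos (ν * Real.pi) ≤ Real.cos (ν * θ) :=
    Real.cos_le_cos_of_nonneg_of_le_pi (by positivity) (by nlinarith [Real.pi_pos]) (by gcongr)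
  have h3 := mul_le_mul_of_nonneg_left hcos (mul_nonneg hx (Real.exp_pos (ν * u)).le)
  have h4 := mul_nonpos_of_nonneg_of_nonpos (Real.exp_pos u).le ht
  nlinarith

theorem cos_mul_pi_pos {ν : ℝ} (hν₀ : 0 < ν) (hν₁ : ν < 1 / 2) : 0 < Real.cos (ν * Real.pi) :=
  Real.cos_pos_of_mem_Ioo ⟨by nlinarith [Real.pi_pos], by nlinarith [Real.pi_pos]⟩

theorem differentiable_wrightKernel (ν b x t : ℝ) : Differentiable ℂ (wrightKernel ν b x t) := by
  unfold wrightKernel; fun_prop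

theorem integrable_wrightKernel_bound {ν b x : ℝ} (hν₀ : 0 < ν) (hν₁ : ν < 1 / 2) (hb : b < 1)
    (hx : 0 < x) : Integrable fun u : ℝ =>
      Real.exp ((1 - b) * u - x * Real.cos (ν * Real.pi) * Real.exp (ν * u)) :=
  integrable_exp_mul_sub_exp_mul (sub_pos.2 hb) (mul_pos hx (cos_mul_pi_pos hν₀ hν₁)) hν₀

theorem integral_wrightKernel_eq {ν b x t θ₁ θ₂ : ℝ} (hν₀ : 0 < ν) (hν₁ : ν < 1 / 2) (hb : b < 1)
    (hx : 0 < x)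
    (h : ∀ θ ∈ uIcc θ₁ θ₂, 0 ≤ θ ∧ θ ≤ Real.pi ∧ t * Real.cos θ ≤ 0) :
    ∫ u : ℝ, wrightKernel ν b x t (u + θ₁ * Complex.I) =
      ∫ u : ℝ, wrightKernel ν b x t (u + θ₂ * Complex.I) := by
  have hc := mul_pos hx (cos_mul_pi_pos hν₀ hν₁)
  exact integral_horizontal_line_eq (differentiable_wrightKernel ν b x t)
    (integrable_wrightKernel_bound hν₀ hν₁ hb hx)
    (tendsto_exp_mul_sub_exp_mul_atTop hc hν₀)
    (tendsto_exp_mul_sub_exp_mul_atBot (sub_pos.2 hb) hc) fun u θ hθ =>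
      norm_wrightKernel_le hν₀ hν₁ b hx.le (h θ hθ).1 (h θ hθ).2.1 (h θ hθ).2.2 u

/-- The inverse Laplace transform of `p^(-b) exp (-x p^ν)`, times `π`, as an integral along the
imaginary axis. -/
def wrightH (ν b x t : ℝ) : ℝ :=
  (∫ u : ℝ, wrightKernel ν b x t (u + (Real.pi / 2 : ℝ) * Complex.I)).im

theorem norm_wrightKernel_pi_div_two_le {ν : ℝ} (hν₀ : 0 < ν) (hν₁ : ν < 1 / 2) (b : ℝ) {x : ℝ}
    (hx : 0 ≤ x) (t u : ℝ) :
    ‖wrightKernel ν b x t (u + (Real.pi / 2 : ℝ) * Complex.I)‖ ≤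
      Real.exp ((1 - b) * u - x * Real.cos (ν * Real.pi) * Real.exp (ν * u)) :=
  norm_wrightKernel_le hν₀ hν₁ b hx (by positivity) (by linarith [Real.pi_pos])
    (by simp [Real.cos_pi_div_two]) u

theorem wrightH_of_pos {ν b x t : ℝ} (hν₀ : 0 < ν) (hν₁ : ν < 1 / 2) (hb : b < 1) (hx : 0 < x)
    (ht : 0 < t) : wrightH ν b x t = Real.pi * wrightV ν b x t := by
  have hpi := Real.pi_pos
  rw [← im_integral_wrightKernel_pi hν₀ (by linarith) hb ht, wrightH,
    integral_wrightKernel_eq (θ₁ := Real.pi / 2) (θ₂ := Real.pi) hν₀ hν₁ hb hx]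
  intro θ hθ
  rw [uIcc_of_le (by linarith)] at hθ
  exact ⟨by linarith [hθ.1], hθ.2, mul_nonpos_of_nonneg_of_nonpos ht.le
    (Real.cos_nonpos_of_pi_div_two_le_of_le hθ.1 (by linarith [hθ.2]))⟩

/-- For `t ≤ 0` the line can be moved down to the positive real axis of `ζ`, where the integrand is
real. -/
theorem wrightH_of_nonpos {ν b x t : ℝ} (hν₀ : 0 < ν) (hν₁ : ν < 1 / 2) (hb : b < 1) (hx : 0 < x)
    (ht : t ≤ 0) : wrightH ν b x t = 0 := by
  have hpi := Real.pi_pos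
  rw [wrightH, integral_wrightKernel_eq (θ₁ := Real.pi / 2) (θ₂ := 0) hν₀ hν₁ hb hx]
  · have h : ∀ u : ℝ, wrightKernel ν b x t (u + (0 : ℝ) * Complex.I) =
        (Real.exp (t * Real.exp u + (1 - b) * u - x * Real.exp (ν * u)) : ℝ) := fun u => by
      simp [wrightKernel]
    simp_rw [h]
    rw [integral_complex_ofReal, Complex.ofReal_im]
  · intro θ hθ
    rw [uIcc_of_ge (by linarith)] at hθ
    exact ⟨hθ.1, by linarith [hθ.2], mul_nonpos_of_nonpos_of_nonneg ht
      (Real.cos_nonneg_of_mem_Icc ⟨by linarith [hθ.1], hθ.2⟩)⟩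

theorem continuous_wrightKernel_uncurry (ν b x θ : ℝ) :
    Continuous fun p : ℝ × ℝ => wrightKernel ν b x p.1 (p.2 + θ * Complex.I) := by
  unfold wrightKernel; fun_prop

theorem integrable_wrightKernel {ν b x : ℝ} (hν₀ : 0 < ν) (hν₁ : ν < 1 / 2) (hb : b < 1)
    (hx : 0 < x) (t : ℝ) :
    Integrable fun u : ℝ => wrightKernel ν b x t (u + (Real.pi / 2 : ℝ) * Complex.I) :=
  (integrable_wrightKernel_bound hν₀ hν₁ hb hx).mono'
    ((continuous_wrightKernel_uncurry ν b x _).comp (by fun_prop :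
      Continuous fun u : ℝ => (t, u))).aestronglyMeasurable
    (Eventually.of_forall (norm_wrightKernel_pi_div_two_le hν₀ hν₁ b hx.le t))

theorem continuous_wrightH {ν b x : ℝ} (hν₀ : 0 < ν) (hν₁ : ν < 1 / 2) (hb : b < 1) (hx : 0 < x) :
    Continuous (wrightH ν b x) :=
  Complex.continuous_im.comp <| continuous_of_dominated
    (fun t => (integrable_wrightKernel hν₀ hν₁ hb hx t).aestronglyMeasurable)
    (fun t => Eventually.of_forall (norm_wrightKernel_pi_div_two_le hν₀ hν₁ b hx.le t))
    (integrable_wrightKernel_bound hν₀ hν₁ hb hx)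
    (Eventually.of_forall fun u => (continuous_wrightKernel_uncurry ν b x _).comp
      (by fun_prop : Continuous fun t : ℝ => (t, u)))

theorem tendsto_wrightV_zero {ν b x : ℝ} (hν₀ : 0 < ν) (hν₁ : ν < 1 / 2) (hb : b < 1)
    (hx : 0 < x) : Tendsto (wrightV ν b x) (𝓝[>] 0) (𝓝 0) := by
  have h := (continuous_wrightH hν₀ hν₁ hb hx).continuousAt (x := 0)
  rw [ContinuousAt, wrightH_of_nonpos hν₀ hν₁ hb hx le_rfl] at h
  have h1 := (h.mono_left (nhdsWithin_le_nhds (s := Ioi 0))).const_mul Real.pi⁻¹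
  rw [mul_zero] at h1
  refine h1.congr' ?_
  filter_upwards [self_mem_nhdsWithin] with t ht
  rw [wrightH_of_pos hν₀ hν₁ hb hx ht, inv_mul_cancel_left₀ Real.pi_ne_zero]

/-- At `t = z^(-1/ν)` one has `V_b(1, t) = z^((1-b)/ν) Φ_b(z)`, so decay at infinity follows from
the vanishing of `V_b` as `t → 0`. -/
theorem tendsto_wrightPhi_atTop {ν b : ℝ} (hν₀ : 0 < ν) (hν₁ : ν < 1 / 2) (hb : b < 1) :
    Tendsto (wrightPhi ν b) atTop (𝓝 0) := by
  have hlim : Tendsto (fun z : ℝ => z ^ (-ν⁻¹)) atTop (𝓝[>] 0) :=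
    tendsto_nhdsWithin_iff.2 ⟨tendsto_rpow_neg_atTop (inv_pos.2 hν₀),
      (eventually_gt_atTop 0).mono fun z hz => Real.rpow_pos_of_pos hz _⟩
  have h1 := ((tendsto_wrightV_zero hν₀ hν₁ hb one_pos).comp hlim).mul
    (tendsto_rpow_neg_atTop (mul_pos (inv_pos.2 hν₀) (sub_pos.2 hb)))
  rw [zero_mul] at h1
  refine h1.congr' ((eventually_gt_atTop 0).mono fun z hz => ?_)
  simp only [Function.comp, wrightV]
  rw [← Real.rpow_mul hz.le, ← Real.rpow_mul hz.le, one_mul, mul_right_comm, ← Real.rpow_add hz,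
    show -ν⁻¹ * (b - 1) + -(ν⁻¹ * (1 - b)) = 0 by ring, Real.rpow_zero, one_mul,
    show -ν⁻¹ * -ν = 1 by field_simp, Real.rpow_one]

/-! ### Fractional integration of `V_b` in time. -/

theorem integrableOn_rpow_mul_exp_neg {β ε : ℝ} (hβ : 0 < β) (hε : 0 < ε) :
    IntegrableOn (fun σ : ℝ => σ ^ (β - 1) * Real.exp (-ε * σ)) (Ioi 0) := by
  simpa using integrableOn_rpow_mul_exp_neg_mul_rpow (p := 1) (s := β - 1) (b := ε)
    (by linarith) one_pos hε

/-- The kernel at time `t - σ` in terms of the kernel at time `t`, on the imaginary axis. -/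
theorem wrightKernel_sub (ν b x t σ u : ℝ) :
    wrightKernel ν b x (t - σ) (u + (Real.pi / 2 : ℝ) * Complex.I) =
      wrightKernel ν b x t (u + (Real.pi / 2 : ℝ) * Complex.I) *
        Complex.exp (-(Complex.I * Real.exp u) * σ) := by
  have h : Complex.exp (u + (Real.pi / 2 : ℝ) * Complex.I) = Complex.I * Real.exp u := by
    rw [Complex.exp_add, Complex.ofReal_div, Complex.ofReal_ofNat, Complex.exp_pi_div_two_mul_I,
      Complex.ofReal_exp, mul_comm]
  rw [wrightKernel, wrightKernel, ← Complex.exp_add, h]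
  congr 1
  push_cast
  ring

/-- The factor `exp (-ε σ)` makes the double integral absolutely convergent, so Fubini applies; the
inner integral is then Euler's integral at `p = ε + i exp u`. -/
theorem integral_regularized_mul_wrightH {ν b x β ε : ℝ} (hν₀ : 0 < ν) (hν₁ : ν < 1 / 2)
    (hb : b < 1) (hx : 0 < x) (hβ : 0 < β) (hε : 0 < ε) (t : ℝ) :
    ∫ σ : ℝ in Ioi 0, σ ^ (β - 1) * Real.exp (-ε * σ) * wrightH ν b x (t - σ) =
      (∫ u : ℝ, wrightKernel ν b x t (u + (Real.pi / 2 : ℝ) * Complex.I) *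
        (Real.Gamma β * Complex.exp (-β * Complex.log (ε + Complex.I * Real.exp u)))).im := by
  set G : ℝ → ℝ → ℂ := fun σ u => ((σ ^ (β - 1) * Real.exp (-ε * σ) : ℝ) : ℂ) *
    wrightKernel ν b x (t - σ) (u + (Real.pi / 2 : ℝ) * Complex.I) with hG
  have hint : Integrable (Function.uncurry G) ((volume.restrict (Ioi 0)).prod volume) := by
    refine ((integrableOn_rpow_mul_exp_neg hβ hε).mul_prod
      (integrable_wrightKernel_bound hν₀ hν₁ hb hx)).mono' ?_ ?_
    · refine Measurable.aestronglyMeasurable ?_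
      simp only [hG, Function.uncurry_def]
      refine Measurable.mul (by fun_prop) ?_
      exact ((continuous_wrightKernel_uncurry ν b x (Real.pi / 2)).comp
        (by fun_prop : Continuous fun p : ℝ × ℝ => (t - p.1, p.2))).measurable
    · have hpos : ∀ᵐ p : ℝ × ℝ ∂((volume.restrict (Ioi 0)).prod volume), p.1 ∈ Ioi (0 : ℝ) :=
        (Measure.quasiMeasurePreserving_fst).ae (ae_restrict_mem measurableSet_Ioi)
      filter_upwards [hpos] with p hp
      have hp' : 0 ≤ p.1 ^ (β - 1) * Real.exp (-ε * p.1) :=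
        mul_nonneg (Real.rpow_nonneg (le_of_lt hp) _) (Real.exp_pos _).le
      simp only [hG, Function.uncurry_def, norm_mul, Complex.norm_real, Real.norm_eq_abs]
      rw [← abs_mul, abs_of_nonneg hp']
      exact mul_le_mul_of_nonneg_left
        (norm_wrightKernel_pi_div_two_le hν₀ hν₁ b hx.le _ _) hp'
  have hleft : ∀ σ : ℝ, σ ^ (β - 1) * Real.exp (-ε * σ) * wrightH ν b x (t - σ) =
      (∫ u, G σ u).im := fun σ => by
    rw [integral_const_mul, Complex.im_ofReal_mul, wrightH]
  have hright : ∀ u : ℝ, ∫ σ : ℝ in Ioi 0, G σ u =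
      wrightKernel ν b x t (u + (Real.pi / 2 : ℝ) * Complex.I) *
        (Real.Gamma β * Complex.exp (-β * Complex.log (ε + Complex.I * Real.exp u))) := fun u => by
    rw [← integral_rpow_mul_cexp_neg_mul hβ (p := ε + Complex.I * Real.exp u) (by simpa),
      ← integral_const_mul]
    refine integral_congr_ae (Eventually.of_forall fun σ => ?_)
    simp only [hG]
    rw [wrightKernel_sub, neg_add, add_mul, Complex.exp_add]
    push_cast
    ring
  simp_rw [hleft, ← hright]
  rw [← integral_integral_swap hint]
  exact Complex.imCLM.integral_comp_comm hint.integral_prod_left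

/-- Since `|ε + i exp u| ≥ exp u`, the bound is uniform in `ε` and dominates the passage to `ε = 0`.
-/
theorem norm_cexp_neg_mul_log_le {β ε : ℝ} (hβ : 0 < β) (u : ℝ) :
    ‖Complex.exp (-β * Complex.log (ε + Complex.I * Real.exp u))‖ ≤ Real.exp (-β * u) := by
  have him : (ε + Complex.I * Real.exp u : ℂ).im = Real.exp u := by
    simp [Complex.exp_ofReal_re]
  have h : u ≤ Real.log ‖(ε + Complex.I * Real.exp u : ℂ)‖ := by
    have h1 := Complex.abs_im_le_norm (ε + Complex.I * Real.exp u : ℂ)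
    rw [him, abs_of_pos (Real.exp_pos _)] at h1
    exact (Real.le_log_iff_exp_le ((Real.exp_pos u).trans_le h1)).2 h1
  rw [Complex.norm_exp, Real.exp_le_exp, ← Complex.ofReal_neg, Complex.re_ofReal_mul,
    Complex.log_re]
  nlinarith

theorem log_I_mul_exp (u : ℝ) :
    Complex.log (Complex.I * Real.exp u) = u + (Real.pi / 2 : ℝ) * Complex.I := by
  rw [mul_comm, Complex.log_ofReal_mul (Real.exp_pos u) Complex.I_ne_zero, Real.log_exp,
    Complex.log_I]
  push_cast
  ring

theorem wrightKernel_mul_cexp (ν b β x t : ℝ) (w : ℂ) :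
    wrightKernel ν b x t w * Complex.exp (-β * w) = wrightKernel ν (b + β) x t w := by
  rw [wrightKernel, wrightKernel, ← Complex.exp_add]
  congr 1
  push_cast
  ring

theorem tendsto_regularized_right {ν b x β : ℝ} (hν₀ : 0 < ν) (hν₁ : ν < 1 / 2)
    (hx : 0 < x) (hβ : 0 < β) (hbβ : b + β < 1) (t : ℝ) :
    Tendsto (fun ε : ℝ => (∫ u : ℝ, wrightKernel ν b x t (u + (Real.pi / 2 : ℝ) * Complex.I) *
        (Real.Gamma β * Complex.exp (-β * Complex.log (ε + Complex.I * Real.exp u)))).im)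
      (𝓝[>] 0) (𝓝 (Real.Gamma β * wrightH ν (b + β) x t)) := by
  have hlim : Real.Gamma β * wrightH ν (b + β) x t =
      (∫ u : ℝ, wrightKernel ν b x t (u + (Real.pi / 2 : ℝ) * Complex.I) * (Real.Gamma β *
        Complex.exp (-β * (u + (Real.pi / 2 : ℝ) * Complex.I)))).im := by
    have h : ∀ u : ℝ, wrightKernel ν b x t (u + (Real.pi / 2 : ℝ) * Complex.I) * (Real.Gamma β *
        Complex.exp (-β * (u + (Real.pi / 2 : ℝ) * Complex.I))) = Real.Gamma β *
          wrightKernel ν (b + β) x t (u + (Real.pi / 2 : ℝ) * Complex.I) := fun u => by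
      rw [mul_left_comm, wrightKernel_mul_cexp]
    simp_rw [h]
    rw [integral_const_mul, Complex.im_ofReal_mul, wrightH]
  rw [hlim]
  refine (Complex.continuous_im.tendsto _).comp ?_
  refine tendsto_integral_filter_of_dominated_convergence
    (fun u => Real.Gamma β * Real.exp ((1 - (b + β)) * u -
      x * Real.cos (ν * Real.pi) * Real.exp (ν * u))) (Eventually.of_forall fun ε => ?_)
    (Eventually.of_forall fun ε => Eventually.of_forall fun u => ?_)
    ((integrable_wrightKernel_bound hν₀ hν₁ hbβ hx).const_mul _)
    (Eventually.of_forall fun u => ?_)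
  · refine Measurable.aestronglyMeasurable (Measurable.mul ?_ (by fun_prop))
    exact ((continuous_wrightKernel_uncurry ν b x (Real.pi / 2)).comp
      (by fun_prop : Continuous fun u : ℝ => (t, u))).measurable
  · have hΓ := Real.Gamma_pos_of_pos hβ
    rw [norm_mul, norm_mul, Complex.norm_real, Real.norm_eq_abs, abs_of_pos hΓ, mul_left_comm]
    refine mul_le_mul_of_nonneg_left ?_ hΓ.le
    refine (mul_le_mul (norm_wrightKernel_pi_div_two_le hν₀ hν₁ b hx.le t u)
      (norm_cexp_neg_mul_log_le hβ u) (norm_nonneg _) (Real.exp_pos _).le).trans_eq ?_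
    rw [← Real.exp_add]
    congr 1
    ring
  · refine Tendsto.const_mul _ (Tendsto.const_mul _ ?_)
    rw [← log_I_mul_exp]
    have hslit : ((0 : ℝ) : ℂ) + Complex.I * Real.exp u ∈ Complex.slitPlane :=
      Complex.mem_slitPlane_iff.2 (Or.inr (by simp [Complex.exp_ofReal_re, Real.exp_ne_zero]))
    have hc : ContinuousAt (fun ε : ℝ =>
        Complex.exp (-β * Complex.log (ε + Complex.I * Real.exp u))) 0 :=
      ContinuousAt.cexp (ContinuousAt.mul continuousAt_const (ContinuousAt.clog
        (f := fun ε : ℝ => (ε : ℂ) + Complex.I * Real.exp u) (by fun_prop) hslit))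
    have := hc.tendsto
    rw [Complex.ofReal_zero, zero_add] at this
    exact this.mono_left nhdsWithin_le_nhds

theorem exists_abs_wrightH_le {ν b x : ℝ} (hν₀ : 0 < ν) (hν₁ : ν < 1 / 2) (hb : b < 1)
    (hx : 0 < x) : ∃ K, ∀ t, |wrightH ν b x t| ≤ K := by
  refine ⟨∫ u : ℝ, Real.exp ((1 - b) * u - x * Real.cos (ν * Real.pi) * Real.exp (ν * u)),
    fun t => (Complex.abs_im_le_norm _).trans ?_⟩
  exact norm_integral_le_of_norm_le (integrable_wrightKernel_bound hν₀ hν₁ hb hx)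
    (Eventually.of_forall (norm_wrightKernel_pi_div_two_le hν₀ hν₁ b hx.le t))

theorem integrableOn_rpow_Ioc {β : ℝ} (hβ : 0 < β) {t : ℝ} (ht : 0 ≤ t) :
    IntegrableOn (fun σ : ℝ => σ ^ (β - 1)) (Ioc 0 t) :=
  (intervalIntegrable_iff_integrableOn_Ioc_of_le ht).1
    (intervalIntegral.intervalIntegrable_rpow' (by linarith))

theorem tendsto_regularized_left {ν b x β t : ℝ} (hν₀ : 0 < ν) (hν₁ : ν < 1 / 2)
    (hb : b < 1) (hx : 0 < x) (hβ : 0 < β) (ht : 0 < t) :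
    Tendsto (fun ε : ℝ =>
        ∫ σ : ℝ in Ioi 0, σ ^ (β - 1) * Real.exp (-ε * σ) * wrightH ν b x (t - σ))
      (𝓝[>] 0) (𝓝 (∫ σ : ℝ in Ioc 0 t, σ ^ (β - 1) * wrightH ν b x (t - σ))) := by
  obtain ⟨K, hK⟩ := exists_abs_wrightH_le hν₀ hν₁ hb hx
  -- As `wrightH` vanishes at nonpositive times, only `σ ≤ t` contributes, and there no damping is
  -- needed.
  have hsupp : ∀ ε : ℝ,
      ∫ σ : ℝ in Ioi 0, σ ^ (β - 1) * Real.exp (-ε * σ) * wrightH ν b x (t - σ) =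
        ∫ σ : ℝ in Ioc 0 t, σ ^ (β - 1) * Real.exp (-ε * σ) * wrightH ν b x (t - σ) := fun ε =>
    (setIntegral_eq_of_subset_of_forall_sdiff_eq_zero measurableSet_Ioi Ioc_subset_Ioi_self
      fun σ hσ => by
        have : t < σ := by
          by_contra h
          exact hσ.2 ⟨hσ.1, not_lt.1 h⟩
        rw [wrightH_of_nonpos hν₀ hν₁ hb hx (by linarith), mul_zero])
  simp_rw [hsupp]
  have hHm : Measurable fun σ => wrightH ν b x (t - σ) :=
    ((continuous_wrightH hν₀ hν₁ hb hx).comp (by fun_prop)).measurable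
  refine tendsto_integral_filter_of_dominated_convergence (fun σ => σ ^ (β - 1) * K)
    (Eventually.of_forall fun ε => ?_) ?_ ((integrableOn_rpow_Ioc hβ ht.le).mul_const K)
    (Eventually.of_forall fun σ => ?_)
  · exact Measurable.aestronglyMeasurable (by fun_prop)
  · filter_upwards [self_mem_nhdsWithin] with ε hε
    filter_upwards [ae_restrict_mem measurableSet_Ioc] with σ hσ
    have h1 : 0 ≤ σ ^ (β - 1) := Real.rpow_nonneg hσ.1.le _
    rw [Real.norm_eq_abs, abs_mul, abs_mul, abs_of_nonneg h1, abs_of_pos (Real.exp_pos _)]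
    refine mul_le_mul (mul_le_of_le_one_right h1 (Real.exp_le_one_iff.2 ?_)) (hK _)
      (abs_nonneg _) h1
    have := mul_pos (show (0 : ℝ) < ε from hε) hσ.1
    linarith
  · have hc : Continuous fun ε : ℝ => σ ^ (β - 1) * Real.exp (-ε * σ) * wrightH ν b x (t - σ) := by
      fun_prop
    have := hc.tendsto 0
    simp only [neg_zero, zero_mul, Real.exp_zero, mul_one] at this
    exact this.mono_left nhdsWithin_le_nhds

/-- The fractional integral of order `β` raises the index of `V` by `β`. -/
theorem integral_rpow_mul_wrightV {ν b x β t : ℝ} (hν₀ : 0 < ν) (hν₁ : ν < 1 / 2)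
    (hx : 0 < x) (hβ : 0 < β) (hbβ : b + β < 1) (ht : 0 < t) :
    ∫ τ in (0 : ℝ)..t, (t - τ) ^ (β - 1) * wrightV ν b x τ =
      Real.Gamma β * wrightV ν (b + β) x t := by
  have hb : b < 1 := by linarith
  have h1 := tendsto_regularized_left hν₀ hν₁ hb hx hβ ht
  have h2 := tendsto_regularized_right hν₀ hν₁ hx hβ hbβ t
  have h3 := tendsto_nhds_unique (h1.congr' (by
    filter_upwards [self_mem_nhdsWithin] with ε hε
    exact integral_regularized_mul_wrightH hν₀ hν₁ hb hx hβ hε t)) h2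
  have h4 := intervalIntegral.integral_comp_sub_left (a := 0) (b := t)
    (fun τ => (t - τ) ^ (β - 1) * wrightH ν b x τ) t
  simp only [sub_sub_cancel, sub_self, sub_zero] at h4
  rw [← intervalIntegral.integral_of_le ht.le, h4, wrightH_of_pos hν₀ hν₁ hbβ hx ht] at h3
  have h5 : ∫ τ in (0 : ℝ)..t, (t - τ) ^ (β - 1) * wrightH ν b x τ =
      Real.pi * ∫ τ in (0 : ℝ)..t, (t - τ) ^ (β - 1) * wrightV ν b x τ := by
    rw [← intervalIntegral.integral_const_mul, intervalIntegral.integral_of_le ht.le,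
      intervalIntegral.integral_of_le ht.le]
    refine setIntegral_congr_fun measurableSet_Ioc fun τ hτ => ?_
    simp only [wrightH_of_pos hν₀ hν₁ hb hx hτ.1]
    ring
  rw [h5] at h3
  refine mul_left_cancel₀ Real.pi_ne_zero (h3.trans ?_)
  ring

theorem intervalIntegrable_rpow_sub_mul_wrightV {ν b x β t : ℝ} (hν₀ : 0 < ν) (hν₁ : ν < 1 / 2)
    (hb : b < 1) (hx : 0 < x) (hβ : 0 < β) (ht : 0 < t) :
    IntervalIntegrable (fun τ => (t - τ) ^ (β - 1) * wrightV ν b x τ) volume 0 t := by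
  have h1 : IntervalIntegrable (fun τ : ℝ => (t - τ) ^ (β - 1)) volume 0 t := by
    have := (intervalIntegral.intervalIntegrable_rpow' (a := t) (b := 0) (r := β - 1)
      (by linarith)).comp_sub_left t
    simpa using this
  have h2 := h1.mul_continuousOn
    ((continuous_wrightH hν₀ hν₁ hb hx).const_mul Real.pi⁻¹).continuousOn
  refine h2.congr fun τ hτ => ?_
  rw [uIoc_of_le ht.le] at hτ
  simp only [wrightH_of_pos hν₀ hν₁ hb hx hτ.1]
  rw [inv_mul_cancel_left₀ Real.pi_ne_zero]

/-! ### Positivity of the Mainardi function and monotonicity. -/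

theorem exists_isMinOn_Ici_of_tendsto_zero {f : ℝ → ℝ} (hf : Continuous f)
    (hlim : Tendsto f atTop (𝓝 0)) {a z : ℝ} (hz : a ≤ z) (hfz : f z < 0) :
    ∃ z₀ ∈ Ici a, IsMinOn f (Ici a) z₀ := by
  obtain ⟨R, hR, hzR⟩ := ((hlim.eventually (lt_mem_nhds hfz)).exists_forall_of_atTop.imp
    fun R hR => (⟨fun y hy => hR y ((le_max_left _ _).trans hy), le_max_right R z⟩ :
      (∀ y ≥ max R z, f z < f y) ∧ z ≤ max R z))
  obtain ⟨z₀, hz₀, hmin⟩ := (isCompact_Icc (a := a) (b := max R z)).exists_isMinOn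
    ⟨z, hz, hzR⟩ hf.continuousOn
  refine ⟨z₀, hz₀.1, fun y hy => ?_⟩
  rcases le_total y (max R z) with h | h
  · exact hmin ⟨hy, h⟩
  · exact (hmin (show z ∈ Icc a (max R z) from ⟨hz, hzR⟩)).trans (hR y h).le

/-- The product is `-(1 - τ)^(1-ν)` times the slope of `h` at `1`, and the slope stays bounded. -/
theorem tendsto_rpow_neg_mul_of_hasDerivAt {h : ℝ → ℝ} {h' ν : ℝ} (hν₁ : ν < 1)
    (hh : HasDerivAt h h' 1) (h1 : h 1 = 0) :
    Tendsto (fun τ : ℝ => (1 - τ) ^ (-ν) * h τ) (𝓝[<] 1) (𝓝 0) := by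
  have hs : Tendsto (slope h 1) (𝓝[<] 1) (𝓝 h') :=
    (hasDerivAt_iff_tendsto_slope.1 hh).mono_left (nhdsWithin_mono _ fun τ hτ => ne_of_lt hτ)
  have hp : Tendsto (fun τ : ℝ => (1 - τ) ^ (1 - ν)) (𝓝[<] 1) (𝓝 0) := by
    have : Continuous fun τ : ℝ => (1 - τ) ^ (1 - ν) :=
      Continuous.rpow_const (by fun_prop) fun _ => Or.inr (by linarith)
    have h0 := this.tendsto 1
    rw [sub_self, Real.zero_rpow (by linarith)] at h0
    exact h0.mono_left nhdsWithin_le_nhds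
  have := (hp.mul hs).neg
  rw [zero_mul, neg_zero] at this
  refine this.congr' ?_
  filter_upwards [self_mem_nhdsWithin] with τ hτ
  have hτ' : 0 < 1 - τ := sub_pos.2 hτ
  have hne : τ - 1 ≠ 0 := by linarith
  rw [slope_def_field, h1, sub_zero, show 1 - ν = -ν + 1 by ring, Real.rpow_add_one hτ'.ne']
  field_simp
  ring

/-- Extremum principle. At a negative minimum `m = Φ_{1-ν}(z₀)` the derivative `-Φ_{1-2ν}(z₀)` is
zero. But `Φ_{1-2ν}(z₀)` is, up to `Γ(1-ν)`, the integral of `(1 - τ)^(-ν) v'(τ)` over `(0, 1)` with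
`v = V_{1-ν}(z₀, ·)`. Minimality gives `v(τ) ≥ m τ^(-ν)` with equality at `τ = 1`, and integration
by parts then makes that integral negative. -/
theorem wrightPhi_one_sub_nonneg {ν z : ℝ} (hν₀ : 0 < ν) (hν₁ : ν < 1 / 2) (hz : 0 ≤ z) :
    0 ≤ wrightPhi ν (1 - ν) z := by
  by_contra! hneg
  have hν1 : ν < 1 := by linarith
  obtain ⟨z₀, hz₀, hmin⟩ := exists_isMinOn_Ici_of_tendsto_zero
    (continuous_wrightPhi hν₀ hν1 (b := 1 - ν) (by linarith))
    (tendsto_wrightPhi_atTop hν₀ hν₁ (by linarith)) hz hneg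
  set m := wrightPhi ν (1 - ν) z₀ with hm
  have hmneg : m < 0 := lt_of_le_of_lt (hmin hz) hneg
  have hz₀' : 0 < z₀ := by
    refine lt_of_le_of_ne hz₀ fun h => ?_
    rw [hm, ← h, wrightPhi_zero] at hmneg
    exact absurd hmneg (inv_pos.2 (Real.Gamma_pos_of_pos (by linarith))).le.not_gt
  have hcrit : wrightPhi ν (1 - 2 * ν) z₀ = 0 := by
    have h := (hmin.isLocalMin (Ici_mem_nhds hz₀')).hasDerivAt_eq_zero
      (hasDerivAt_wrightPhi hν₀ hν1 (by linarith) z₀)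
    rwa [neg_eq_zero, show 1 - ν - ν = 1 - 2 * ν by ring] at h
  have hconv := integral_rpow_mul_wrightV (b := -ν) (β := 1 - ν) hν₀ hν₁ hz₀' (by linarith)
    (by linarith) one_pos
  have hint := intervalIntegrable_rpow_sub_mul_wrightV (b := -ν) (β := 1 - ν) (t := 1) hν₀ hν₁
    (by linarith) hz₀' (by linarith) one_pos
  rw [show -ν + (1 - ν) = 1 - 2 * ν by ring, wrightV, Real.one_rpow, Real.one_rpow, mul_one, hcrit,
    mul_zero, mul_zero] at hconv
  rw [show 1 - ν - 1 = -ν by ring] at hconv hint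
  set v := wrightV ν (1 - ν) z₀ with hv
  have hv_eq : ∀ τ, v τ = τ ^ (-ν) * wrightPhi ν (1 - ν) (z₀ * τ ^ (-ν)) := fun τ => by
    rw [hv, wrightV, show 1 - ν - 1 = -ν by ring]
  have hv_deriv : ∀ τ, 0 < τ → HasDerivAt v (wrightV ν (-ν) z₀ τ) τ := fun τ hτ => by
    have := hasDerivAt_wrightV (b := 1 - ν) hν₀ hν1 (by linarith) z₀ hτ
    rwa [show 1 - ν - 1 = -ν by ring] at this
  -- The subtracted power matches `v` at `0` and `1`, so the boundary terms vanish, while `v ≥ m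
  -- τ^(-ν)` still gives `h ≥ m τ^(-ν) (1 - τ)`.
  set h : ℝ → ℝ := fun τ => v τ - m * τ ^ (1 - ν) with hh
  have hh_deriv : ∀ τ, 0 < τ →
      HasDerivAt h (wrightV ν (-ν) z₀ τ - m * ((1 - ν) * τ ^ (-ν))) τ := fun τ hτ => by
    have := (Real.hasDerivAt_rpow_const (p := 1 - ν) (Or.inl hτ.ne')).const_mul m
    rw [show 1 - ν - 1 = -ν by ring] at this
    exact (hv_deriv τ hτ).sub this
  have hh1 : h 1 = 0 := by simp [hh, hv_eq, hm]
  have hh0 : h 0 = 0 := by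
    simp [hh, hv_eq, Real.zero_rpow (neg_ne_zero.2 hν₀.ne'), Real.zero_rpow (show 1 - ν ≠ 0 by linarith)]
  set P : ℝ → ℝ := fun τ => (1 - τ) ^ (-ν) * h τ with hP
  have hP_deriv : ∀ τ ∈ Ioo (0 : ℝ) 1, HasDerivAt P (ν * (1 - τ) ^ (-ν - 1) * h τ +
      (1 - τ) ^ (-ν) * (wrightV ν (-ν) z₀ τ - m * ((1 - ν) * τ ^ (-ν)))) τ := fun τ hτ => by
    have h1 : HasDerivAt (fun τ : ℝ => (1 - τ) ^ (-ν)) (ν * (1 - τ) ^ (-ν - 1)) τ := by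
      refine (((hasDerivAt_id τ).const_sub 1).rpow_const (p := -ν)
        (Or.inl (sub_pos.2 hτ.2).ne')).congr_deriv ?_
      simp
    exact h1.mul (hh_deriv τ hτ.1)
  have hP_cont : ContinuousOn P (Icc 0 1) := by
    intro τ hτ
    rcases hτ.1.eq_or_lt with rfl | h0
    · have hlim : ContinuousWithinAt h (Ioi 0) 0 := by
        have h1 := tendsto_wrightV_zero (b := 1 - ν) hν₀ hν₁ (by linarith) hz₀'
        have h2 : Tendsto (fun τ : ℝ => m * τ ^ (1 - ν)) (𝓝[>] 0) (𝓝 (m * (0 : ℝ) ^ (1 - ν))) :=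
          ((Real.continuous_rpow_const (by linarith)).tendsto 0).const_mul m |>.mono_left
            nhdsWithin_le_nhds
        rw [ContinuousWithinAt, hh0]
        rw [Real.zero_rpow (by linarith), mul_zero] at h2
        simpa using h1.sub h2
      have hone : ContinuousWithinAt (fun τ : ℝ => (1 - τ) ^ (-ν)) (Icc 0 1) 0 :=
        (ContinuousAt.rpow_const (by fun_prop) (Or.inl (by norm_num))).continuousWithinAt
      exact hone.mul ((continuousWithinAt_Ioi_iff_Ici.1 hlim).mono Icc_subset_Ici_self)
    rcases hτ.2.eq_or_lt with rfl | h1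
    · have hlim : ContinuousWithinAt P (Iio 1) 1 := by
        have h1 := tendsto_rpow_neg_mul_of_hasDerivAt hν1 (hh_deriv 1 one_pos) hh1
        rw [ContinuousWithinAt]
        simpa [hP, hh1] using h1
      exact (continuousWithinAt_Iio_iff_Iic.1 hlim).mono Icc_subset_Iic_self
    · exact (hP_deriv τ ⟨h0, h1⟩).continuousAt.continuousWithinAt
  -- The integrand `(1 - τ)^(-ν) v'` lies below the derivative of `P + m (1 - 2ν) τ`. Only this
  -- one-sided comparison is used, so `P'` itself need not be shown integrable.
  have hle := intervalIntegral.integral_le_sub_of_hasDeriv_right_of_le zero_le_one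
    (hP_cont.add (by fun_prop : ContinuousOn (fun τ : ℝ => m * (1 - 2 * ν) * τ) (Icc 0 1)))
    (fun τ hτ => ((hP_deriv τ hτ).add
      ((hasDerivAt_id τ).const_mul (m * (1 - 2 * ν)))).hasDerivWithinAt)
    ((intervalIntegrable_iff_integrableOn_Icc_of_le zero_le_one).1 hint) fun τ hτ => by
      have hτ' : 0 < 1 - τ := sub_pos.2 hτ.2
      have ha := Real.rpow_pos_of_pos hτ' (-ν - 1)
      have hc : 1 ≤ τ ^ (-ν) :=
        Real.one_le_rpow_of_pos_of_le_one_of_nonpos hτ.1 hτ.2.le (by linarith)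
      have hpow : (1 - τ) ^ (-ν) = (1 - τ) ^ (-ν - 1) * (1 - τ) := by
        rw [← Real.rpow_add_one hτ'.ne']; congr 1; ring
      have hpow' : τ ^ (1 - ν) = τ ^ (-ν) * τ := by
        rw [← Real.rpow_add_one hτ.1.ne']; congr 1; ring
      have hone : 1 ≤ (1 - τ) ^ (-ν) :=
        Real.one_le_rpow_of_pos_of_le_one_of_nonpos hτ' (by linarith [hτ.1]) (by linarith)
      have hvm : τ ^ (-ν) * m ≤ v τ := by
        rw [hv_eq]
        exact mul_le_mul_of_nonneg_left (hmin (show _ ∈ Ici (0 : ℝ) by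
          have := Real.rpow_nonneg hτ.1.le (-ν)
          exact mul_nonneg hz₀'.le this)) (by linarith)
      have h1 : τ ^ (-ν) * m * (1 - τ) ≤ h τ := by
        simp only [hh, hpow']; linarith
      have h2 := mul_le_mul_of_nonneg_left h1 (mul_pos hν₀ ha).le
      -- The two terms in `m` combine to `-m (1 - 2ν) (1 - τ)^(-ν) τ^(-ν)`, which is at least `-m (1
      -- - 2ν)` as both powers are at least `1`.
      have h3 : 0 ≤ -m * (1 - 2 * ν) * ((1 - τ) ^ (-ν) * τ ^ (-ν) - 1) :=
        mul_nonneg (mul_nonneg (by linarith) (by linarith))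
          (by linarith [one_le_mul_of_one_le_of_one_le hone hc])
      have h4 : ν * (1 - τ) ^ (-ν - 1) * (τ ^ (-ν) * m * (1 - τ)) =
          ν * (1 - τ) ^ (-ν) * τ ^ (-ν) * m := by rw [hpow]; ring
      linarith
  rw [hconv] at hle
  have hP0 : P 0 = 0 := by simp [hP, hh0]
  have hP1 : P 1 = 0 := by simp [hP, hh1]
  simp only [Pi.add_apply, hP0, hP1] at hle
  have : m * (1 - 2 * ν) < 0 := mul_neg_of_neg_of_pos hmneg (by linarith)
  linarith

theorem wrightV_zero_nonneg {ν x t : ℝ} (hν₀ : 0 < ν) (hν₁ : ν < 1 / 2) (hx : 0 ≤ x)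
    (ht : 0 ≤ t) : 0 ≤ wrightV ν 0 x t := by
  have h := wrightPhi_sub_one hν₀ (by linarith) (le_refl 1) (x * t ^ (-ν))
  rw [sub_self, zero_mul, zero_add] at h
  have h0 : 0 ≤ x * t ^ (-ν) := mul_nonneg hx (Real.rpow_nonneg ht _)
  rw [wrightV, ← h]
  exact mul_nonneg (Real.rpow_nonneg ht _)
    (mul_nonneg (mul_nonneg hν₀.le h0) (wrightPhi_one_sub_nonneg hν₀ hν₁ h0))

/-- Up to a positive factor this is the fractional integral of order `1 - 2ν` of `V_0 ≥ 0`, taken at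
time `1`. -/
theorem wrightPhi_one_sub_two_mul_nonneg {ν z : ℝ} (hν₀ : 0 < ν) (hν₁ : ν < 1 / 2) (hz : 0 < z) :
    0 ≤ wrightPhi ν (1 - 2 * ν) z := by
  have h := integral_rpow_mul_wrightV (b := 0) (β := 1 - 2 * ν) hν₀ hν₁ hz (by linarith)
    (by linarith) one_pos
  rw [zero_add, wrightV, Real.one_rpow, Real.one_rpow, mul_one, one_mul] at h
  have hG := Real.Gamma_pos_of_pos (show 0 < 1 - 2 * ν by linarith)
  refine nonneg_of_mul_nonneg_right (h ▸ ?_) hG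
  exact intervalIntegral.integral_nonneg zero_le_one fun τ hτ =>
    mul_nonneg (Real.rpow_nonneg (by linarith [hτ.2]) _) (wrightV_zero_nonneg hν₀ hν₁ hz.le hτ.1)

theorem antitoneOn_wrightPhi_one_sub {ν : ℝ} (hν₀ : 0 < ν) (hν₁ : ν < 1 / 2) :
    AntitoneOn (wrightPhi ν (1 - ν)) (Ici 0) := by
  have hd := fun z => hasDerivAt_wrightPhi hν₀ (b := 1 - ν) (by linarith) (by linarith) z
  refine antitoneOn_of_deriv_nonpos (convex_Ici 0)
    (fun z _ => (hd z).continuousAt.continuousWithinAt)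
    (fun z _ => (hd z).differentiableAt.differentiableWithinAt) fun z hz => ?_
  rw [interior_Ici] at hz
  rw [(hd z).deriv, show 1 - ν - ν = 1 - 2 * ν by ring]
  linarith [wrightPhi_one_sub_two_mul_nonneg hν₀ hν₁ hz]

theorem antitoneOn_wrightPhi_one {ν : ℝ} (hν₀ : 0 < ν) (hν₁ : ν < 1 / 2) :
    AntitoneOn (wrightPhi ν 1) (Ici 0) := by
  have hd := fun z => hasDerivAt_wrightPhi hν₀ (b := 1) (by linarith) le_rfl z
  refine antitoneOn_of_deriv_nonpos (convex_Ici 0)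
    (fun z _ => (hd z).continuousAt.continuousWithinAt)
    (fun z _ => (hd z).differentiableAt.differentiableWithinAt) fun z hz => ?_
  rw [interior_Ici] at hz
  rw [(hd z).deriv]
  linarith [wrightPhi_one_sub_nonneg hν₀ hν₁ (le_of_lt hz)]

theorem existsUnique_div_wrightPhi_eq {ν K : ℝ} (hν₀ : 0 < ν) (hν₁ : ν < 1 / 2) (hK : 0 < K) :
    ∃! μ : ℝ, 0 < μ ∧ μ / wrightPhi ν (1 - ν) μ = K := by
  have hanti := antitoneOn_wrightPhi_one_sub hν₀ hν₁
  have hM0 : 0 < wrightPhi ν (1 - ν) 0 := by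
    rw [wrightPhi_zero]; exact inv_pos.2 (Real.Gamma_pos_of_pos (by linarith))
  have hc := continuous_wrightPhi hν₀ (b := 1 - ν) (by linarith) (by linarith)
  set R := K * wrightPhi ν (1 - ν) 0 with hR
  have hRpos : 0 < R := by positivity
  -- Division by zero gives `0`, so `K > 0` and `μ > 0` exclude a zero of the denominator in either
  -- direction.
  have key : ∀ μ, 0 < μ → (μ / wrightPhi ν (1 - ν) μ = K ↔ μ = K * wrightPhi ν (1 - ν) μ) := by
    intro μ hμ
    constructor
    · intro h
      have h0 : wrightPhi ν (1 - ν) μ ≠ 0 := fun h0 => by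
        rw [h0, div_zero] at h; exact hK.ne h
      rwa [div_eq_iff h0] at h
    · intro h
      have h0 : wrightPhi ν (1 - ν) μ ≠ 0 := fun h0 => by
        rw [h0, mul_zero] at h; exact hμ.ne' h
      rwa [div_eq_iff h0]
  -- At `R = K M_ν(0)` the monotonicity gives `K M_ν(R) ≤ R`, hence a sign change on `[0, R]`.
  obtain ⟨μ, hμ, hroot⟩ := intermediate_value_Icc' hRpos.le
    (f := fun μ => K * wrightPhi ν (1 - ν) μ - μ) (by fun_prop)
    (show (0 : ℝ) ∈ Icc _ _ from ⟨by
      have := mul_le_mul_of_nonneg_left (hanti self_mem_Ici (show R ∈ Ici 0 from hRpos.le) hRpos.le)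
        hK.le
      linarith, by linarith⟩)
  have hμ0 : 0 < μ := lt_of_le_of_ne hμ.1 fun h => by
    rw [← h] at hroot; simp only at hroot; linarith
  refine ⟨μ, ⟨hμ0, (key μ hμ0).2 (by linarith)⟩, fun y ⟨hy, hyK⟩ => ?_⟩
  rw [key y hy] at hyK
  rcases le_total y μ with h | h
  · have := mul_le_mul_of_nonneg_left (hanti (show y ∈ Ici 0 from hy.le) hμ.1 h) hK.le
    linarith
  · have := mul_le_mul_of_nonneg_left (hanti (show μ ∈ Ici 0 from hμ.1)
      (show y ∈ Ici 0 from hy.le) h) hK.le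
    linarith

/-! ### The Beta integral, for the Caputo derivative of a power. -/

theorem integral_rpow_sub_mul_rpow {a b t : ℝ} (ha : 0 < a) (hb : 0 < b) (ht : 0 < t) :
    ∫ τ in (0 : ℝ)..t, (t - τ) ^ (a - 1) * τ ^ (b - 1) =
      t ^ (a + b - 1) * (Real.Gamma a * Real.Gamma b / Real.Gamma (a + b)) := by
  have h1 := Complex.betaIntegral_scaled b a ht
  have h2 := Complex.Gamma_mul_Gamma_eq_betaIntegral (s := b) (t := a) (by simpa) (by simpa)
  have hG : (Real.Gamma (a + b) : ℂ) ≠ 0 :=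
    Complex.ofReal_ne_zero.2 (Real.Gamma_pos_of_pos (add_pos ha hb)).ne'
  rw [← Complex.ofReal_add, Complex.Gamma_ofReal, Complex.Gamma_ofReal, Complex.Gamma_ofReal,
    add_comm b a] at h2
  rw [← Complex.ofReal_inj, ← intervalIntegral.integral_ofReal]
  have h3 : Complex.betaIntegral b a =
      (Real.Gamma a * Real.Gamma b / Real.Gamma (a + b) : ℝ) := by
    push_cast
    rw [eq_div_iff hG, mul_comm, ← h2, mul_comm]
  rw [h3] at h1
  rw [Complex.ofReal_mul, Complex.ofReal_cpow ht.le]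
  push_cast at h1 ⊢
  rw [add_comm (a : ℂ), ← h1]
  refine intervalIntegral.integral_congr fun τ hτ => ?_
  rw [uIcc_of_le ht.le] at hτ
  rw [mul_comm, Complex.ofReal_cpow hτ.1, Complex.ofReal_cpow (sub_nonneg.2 hτ.2)]
  push_cast
  rfl

theorem intervalIntegrable_rpow_sub_mul_rpow {a b t : ℝ} (ha : 0 < a) (hb : 0 < b) (ht : 0 < t) :
    IntervalIntegrable (fun τ : ℝ => (t - τ) ^ (a - 1) * τ ^ (b - 1)) volume 0 t := by
  -- On each half only one of the two powers can be singular.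
  refine .trans (b := t / 2) ?_ ?_
  · refine (intervalIntegral.intervalIntegrable_rpow' (by linarith)).continuousOn_mul ?_
    refine ContinuousOn.rpow_const (by fun_prop) fun τ hτ => Or.inl ?_
    rw [uIcc_of_le (by linarith)] at hτ
    linarith [hτ.2]
  · have h := (intervalIntegral.intervalIntegrable_rpow' (a := t / 2) (b := 0) (r := a - 1)
      (by linarith)).comp_sub_left t
    rw [sub_zero, show t - t / 2 = t / 2 by ring] at h
    refine h.mul_continuousOn ?_
    refine ContinuousOn.rpow_const (by fun_prop) fun τ hτ => Or.inl ?_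
    rw [uIcc_of_le (by linarith)] at hτ
    linarith [hτ.1]

/-! ### The similarity solution and its verification. -/

variable {ν lam q C μ : ℝ}

theorem stefanU_eq (ν lam q C μ x t : ℝ) : stefanU (2 * ν) lam q C μ x t =
    C + q * lam * Real.Gamma (1 - ν) *
      (wrightPhi ν 1 (x / (lam * t ^ ν)) - wrightPhi ν 1 μ) := by
  rw [stefanU, mul_div_cancel_left₀ ν two_ne_zero]; rfl

theorem stefanS_eq (ν lam μ t : ℝ) : stefanS (2 * ν) lam μ t = lam * μ * t ^ ν := by
  rw [stefanS, mul_div_cancel_left₀ ν two_ne_zero]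

theorem hasDerivAt_stefanU_space (hν₀ : 0 < ν) (hν₁ : ν < 1 / 2) (hlam : 0 < lam) {t : ℝ}
    (ht : 0 < t) (x : ℝ) : HasDerivAt (fun y => stefanU (2 * ν) lam q C μ y t)
      (-(q * Real.Gamma (1 - ν) / t ^ ν * wrightPhi ν (1 - ν) (x / (lam * t ^ ν)))) x := by
  have htν := Real.rpow_pos_of_pos ht ν
  simp_rw [stefanU_eq]
  refine ((((hasDerivAt_wrightPhi hν₀ (by linarith) le_rfl _).comp x
    ((hasDerivAt_id x).div_const (lam * t ^ ν))).sub_const _).const_mul _).const_add _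
    |>.congr_deriv ?_
  simp only [id]
  field_simp

theorem deriv_stefanU_space (hν₀ : 0 < ν) (hν₁ : ν < 1 / 2) (hlam : 0 < lam) {t : ℝ}
    (ht : 0 < t) : deriv (fun y => stefanU (2 * ν) lam q C μ y t) = fun x =>
      -(q * Real.Gamma (1 - ν) / t ^ ν * wrightPhi ν (1 - ν) (x / (lam * t ^ ν))) :=
  funext fun x => (hasDerivAt_stefanU_space hν₀ hν₁ hlam ht x).deriv

theorem hasDerivAt_deriv_stefanU_space (hν₀ : 0 < ν) (hν₁ : ν < 1 / 2) (hlam : 0 < lam) {t : ℝ}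
    (ht : 0 < t) (x : ℝ) : HasDerivAt (deriv fun y => stefanU (2 * ν) lam q C μ y t)
      (q * Real.Gamma (1 - ν) / (lam * t ^ ν * t ^ ν) *
        wrightPhi ν (1 - 2 * ν) (x / (lam * t ^ ν))) x := by
  have htν := Real.rpow_pos_of_pos ht ν
  rw [deriv_stefanU_space hν₀ hν₁ hlam ht]
  refine (((hasDerivAt_wrightPhi hν₀ (b := 1 - ν) (by linarith) (by linarith) _).comp x
    ((hasDerivAt_id x).div_const (lam * t ^ ν))).const_mul _).neg |>.congr_deriv ?_
  simp only [id]
  rw [show 1 - ν - ν = 1 - 2 * ν by ring]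
  field_simp

theorem div_mul_rpow_eq {t : ℝ} (ht : 0 < t) (ν lam x : ℝ) :
    x / (lam * t ^ ν) = x / lam * t ^ (-ν) := by
  rw [Real.rpow_neg ht.le, div_mul_eq_div_div, div_eq_mul_inv (x / lam)]

theorem hasDerivAt_stefanU_time (hν₀ : 0 < ν) (hν₁ : ν < 1 / 2) {t : ℝ} (ht : 0 < t) (x : ℝ) :
    HasDerivAt (fun τ => stefanU (2 * ν) lam q C μ x τ)
      (q * lam * Real.Gamma (1 - ν) * wrightV ν 0 (x / lam) t) t := by
  have h := hasDerivAt_wrightV hν₀ (by linarith) (le_refl 1) (x / lam) ht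
  rw [sub_self] at h
  refine (((h.sub_const (wrightPhi ν 1 μ)).const_mul (q * lam * Real.Gamma (1 - ν))).const_add
    C).congr_of_eventuallyEq ?_
  filter_upwards [lt_mem_nhds ht] with τ hτ
  rw [stefanU_eq, wrightV, sub_self, Real.rpow_zero, one_mul, div_mul_rpow_eq hτ]

theorem caputo_integrand_stefanU (hν₀ : 0 < ν) (hν₁ : ν < 1 / 2) (x t : ℝ) {τ : ℝ} (hτ : 0 < τ) :
    (t - τ) ^ (-(2 * ν)) * deriv (fun τ => stefanU (2 * ν) lam q C μ x τ) τ =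
      q * lam * Real.Gamma (1 - ν) *
        ((t - τ) ^ ((1 - 2 * ν) - 1) * wrightV ν 0 (x / lam) τ) := by
  rw [(hasDerivAt_stefanU_time hν₀ hν₁ hτ x).deriv, show 1 - 2 * ν - 1 = -(2 * ν) by ring]
  ring

theorem caputoDifferentiableAt_stefanU (hν₀ : 0 < ν) (hν₁ : ν < 1 / 2) (hlam : 0 < lam) {x t : ℝ}
    (hx : 0 < x) (ht : 0 < t) :
    CaputoDifferentiableAt (2 * ν) (fun τ => stefanU (2 * ν) lam q C μ x τ) t := by
  refine ⟨fun τ hτ => (hasDerivAt_stefanU_time hν₀ hν₁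
    hτ.1 x).differentiableAt.differentiableWithinAt, ?_⟩
  refine ((intervalIntegrable_rpow_sub_mul_wrightV (b := 0) (β := 1 - 2 * ν) hν₀ hν₁ one_pos
    (div_pos hx hlam) (by linarith) ht).const_mul (q * lam * Real.Gamma (1 - ν))).congr
    fun τ hτ => ?_
  rw [uIoc_of_le ht.le] at hτ
  exact (caputo_integrand_stefanU hν₀ hν₁ x t hτ.1).symm

/-- Both sides are the same multiple of `V_{1-2ν}(x / lam, t)`: on the left from `V_0` by fractional
integration of order `1 - 2ν`, on the right from `Φ_1` by two space derivatives. -/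
theorem caputoDeriv_stefanU (hν₀ : 0 < ν) (hν₁ : ν < 1 / 2) (hlam : 0 < lam) {x t : ℝ}
    (hx : 0 < x) (ht : 0 < t) :
    caputoDeriv (2 * ν) (fun τ => stefanU (2 * ν) lam q C μ x τ) t =
      lam ^ 2 * spaceDeriv₂ (stefanU (2 * ν) lam q C μ) x t := by
  have hG := Real.Gamma_pos_of_pos (show 0 < 1 - 2 * ν by linarith)
  have htν := Real.rpow_pos_of_pos ht ν
  have hint : ∫ τ in (0 : ℝ)..t,
      (t - τ) ^ (-(2 * ν)) * deriv (fun τ => stefanU (2 * ν) lam q C μ x τ) τ =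
      q * lam * Real.Gamma (1 - ν) *
        (Real.Gamma (1 - 2 * ν) * wrightV ν (1 - 2 * ν) (x / lam) t) := by
    have h := integral_rpow_mul_wrightV (b := 0) (β := 1 - 2 * ν) hν₀ hν₁ (div_pos hx hlam)
      (by linarith) (by linarith) ht
    rw [zero_add] at h
    rw [← h, ← intervalIntegral.integral_const_mul, intervalIntegral.integral_of_le ht.le,
      intervalIntegral.integral_of_le ht.le]
    exact setIntegral_congr_fun measurableSet_Ioc fun τ hτ =>
      caputo_integrand_stefanU hν₀ hν₁ x t hτ.1
  rw [caputoDeriv, hint, spaceDeriv₂, (hasDerivAt_deriv_stefanU_space hν₀ hν₁ hlam ht x).deriv,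
    wrightV, ← div_mul_rpow_eq ht, show 1 - 2 * ν - 1 = -(ν + ν) by ring, Real.rpow_neg ht.le,
    Real.rpow_add ht]
  field_simp

theorem hasDerivAt_stefanS (ν lam μ : ℝ) {t : ℝ} (ht : 0 < t) :
    HasDerivAt (stefanS (2 * ν) lam μ) (lam * μ * (ν * t ^ (ν - 1))) t := by
  have h : stefanS (2 * ν) lam μ = fun t => lam * μ * t ^ ν := funext (stefanS_eq ν lam μ)
  rw [h]
  exact (Real.hasDerivAt_rpow_const (Or.inl ht.ne')).const_mul _

theorem caputo_integrand_stefanS (ν lam μ t : ℝ) {τ : ℝ} (hτ : 0 < τ) :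
    (t - τ) ^ (-(2 * ν)) * deriv (stefanS (2 * ν) lam μ) τ =
      lam * μ * ν * ((t - τ) ^ ((1 - 2 * ν) - 1) * τ ^ (ν - 1)) := by
  rw [(hasDerivAt_stefanS ν lam μ hτ).deriv, show 1 - 2 * ν - 1 = -(2 * ν) by ring]
  ring

theorem caputoDifferentiableAt_stefanS (hν₀ : 0 < ν) (hν₁ : ν < 1 / 2) (lam μ : ℝ) {t : ℝ}
    (ht : 0 < t) : CaputoDifferentiableAt (2 * ν) (stefanS (2 * ν) lam μ) t := by
  refine ⟨fun τ hτ => (hasDerivAt_stefanS ν lam μ hτ.1).differentiableAt.differentiableWithinAt,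
    ?_⟩
  refine ((intervalIntegrable_rpow_sub_mul_rpow (a := 1 - 2 * ν) (by linarith) hν₀ ht).const_mul
    (lam * μ * ν)).congr fun τ hτ => ?_
  rw [uIoc_of_le ht.le] at hτ
  exact (caputo_integrand_stefanS ν lam μ t hτ.1).symm

theorem caputoDeriv_stefanS (hν₀ : 0 < ν) (hν₁ : ν < 1 / 2) (lam μ : ℝ) {t : ℝ} (ht : 0 < t) :
    caputoDeriv (2 * ν) (stefanS (2 * ν) lam μ) t =
      lam * μ * (Real.Gamma (1 + ν) / Real.Gamma (1 - ν)) / t ^ ν := by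
  have hG := Real.Gamma_pos_of_pos (show 0 < 1 - 2 * ν by linarith)
  have hG' := Real.Gamma_pos_of_pos (show 0 < 1 - ν by linarith)
  have htν := Real.rpow_pos_of_pos ht ν
  have hint : ∫ τ in (0 : ℝ)..t, (t - τ) ^ (-(2 * ν)) * deriv (stefanS (2 * ν) lam μ) τ =
      lam * μ * ν * (t ^ (1 - 2 * ν + ν - 1) *
        (Real.Gamma (1 - 2 * ν) * Real.Gamma ν / Real.Gamma (1 - 2 * ν + ν))) := by
    rw [← integral_rpow_sub_mul_rpow (by linarith) hν₀ ht, ← intervalIntegral.integral_const_mul,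
      intervalIntegral.integral_of_le ht.le, intervalIntegral.integral_of_le ht.le]
    exact setIntegral_congr_fun measurableSet_Ioc fun τ hτ =>
      caputo_integrand_stefanS ν lam μ t hτ.1
  rw [caputoDeriv, hint, show 1 - 2 * ν + ν - 1 = -ν by ring, show 1 - 2 * ν + ν = 1 - ν by ring,
    Real.rpow_neg ht.le, add_comm 1 ν, Real.Gamma_add_one hν₀.ne']
  field_simp

theorem stefanS_pos (ν : ℝ) (hlam : 0 < lam) (hμ : 0 < μ) {t : ℝ} (ht : 0 < t) :
    0 < stefanS (2 * ν) lam μ t := by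
  rw [stefanS_eq]
  have := Real.rpow_pos_of_pos ht ν
  positivity

theorem spaceDeriv_stefanU (hν₀ : 0 < ν) (hν₁ : ν < 1 / 2) (hlam : 0 < lam) (hμ : 0 < μ) {t : ℝ}
    (ht : 0 < t) {x : ℝ} (hx : x ∈ Icc 0 (stefanS (2 * ν) lam μ t)) :
    spaceDeriv (stefanU (2 * ν) lam q C μ) (stefanS (2 * ν) lam μ) x t =
      -(q * Real.Gamma (1 - ν) / t ^ ν * wrightPhi ν (1 - ν) (x / (lam * t ^ ν))) :=
  (hasDerivAt_stefanU_space hν₀ hν₁ hlam ht x).hasDerivWithinAt.derivWithin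
    (uniqueDiffOn_Icc (stefanS_pos ν hlam hμ ht) x hx)

theorem stefanS_div (ν : ℝ) (hlam : 0 < lam) {t : ℝ} (ht : 0 < t) (μ : ℝ) :
    stefanS (2 * ν) lam μ t / (lam * t ^ ν) = μ := by
  have := Real.rpow_pos_of_pos ht ν
  rw [stefanS_eq]
  field_simp

theorem div_mem_Icc_of_mem_closedRegion (hlam : 0 < lam) {p : ℝ × ℝ}
    (hp : p ∈ closedRegion (stefanS (2 * ν) lam μ)) : p.1 / (lam * p.2 ^ ν) ∈ Icc 0 μ := by
  have h := Real.rpow_pos_of_pos hp.1 ν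
  refine ⟨div_nonneg hp.2.1 (by positivity), ?_⟩
  rw [← stefanS_div ν hlam hp.1 μ]
  exact div_le_div_of_nonneg_right hp.2.2 (by positivity)

/-- In the region the similarity variable runs through `[0, μ]`, where `Φ_1` decreases. This
controls both limits at the origin, although `u₂` need not have a limit there. -/
theorem stefanU_bounds (hν₀ : 0 < ν) (hν₁ : ν < 1 / 2) (hlam : 0 < lam) (hq : 0 < q) {p : ℝ × ℝ}
    (hp : p ∈ closedRegion (stefanS (2 * ν) lam μ)) :
    stefanU (2 * ν) lam q C μ p.1 p.2 ∈ Icc C (C + q * lam * Real.Gamma (1 - ν) *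
      (wrightPhi ν 1 0 - wrightPhi ν 1 μ)) := by
  have hG := Real.Gamma_pos_of_pos (show 0 < 1 - ν by linarith)
  have hA : 0 ≤ q * lam * Real.Gamma (1 - ν) := by positivity
  have hz := div_mem_Icc_of_mem_closedRegion hlam hp
  have hanti := antitoneOn_wrightPhi_one hν₀ hν₁
  have h0μ : (0 : ℝ) ≤ μ := hz.1.trans hz.2
  have h1 := hanti (show _ ∈ Ici (0 : ℝ) from hz.1) (show μ ∈ Ici 0 from h0μ) hz.2
  have h2 := hanti self_mem_Ici (show _ ∈ Ici (0 : ℝ) from hz.1) hz.1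
  rw [stefanU_eq]
  exact ⟨le_add_of_nonneg_right (mul_nonneg hA (sub_nonneg.2 h1)),
    by gcongr⟩

theorem continuousOn_comp_similarity (hlam : 0 < lam) {f : ℝ → ℝ} (hf : Continuous f)
    {D : Set (ℝ × ℝ)} (hD : ∀ p ∈ D, 0 < p.2) :
    ContinuousOn (fun p : ℝ × ℝ => f (p.1 / (lam * p.2 ^ ν))) D := by
  refine hf.comp_continuousOn (continuousOn_fst.div (continuousOn_const.mul
    (continuousOn_snd.rpow_const fun p hp => Or.inl (hD p hp).ne')) fun p hp => ?_)
  have := Real.rpow_pos_of_pos (hD p hp) ν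
  positivity

/-- The region reaches the origin along `x = 0`; without this the lower limit could exceed the upper
one. -/
theorem neBot_nhdsWithin_closedRegion (ν : ℝ) (hlam : 0 < lam) (hμ : 0 < μ) :
    (𝓝[closedRegion (stefanS (2 * ν) lam μ)] ((0 : ℝ), (0 : ℝ))).NeBot := by
  have h : Tendsto (fun t : ℝ => ((0 : ℝ), t)) (𝓝[>] 0)
      (𝓝[closedRegion (stefanS (2 * ν) lam μ)] ((0 : ℝ), (0 : ℝ))) := by
    refine tendsto_nhdsWithin_iff.2 ⟨?_, ?_⟩
    · exact ((by fun_prop : Continuous fun t : ℝ => ((0 : ℝ), t)).tendsto 0).mono_left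
        nhdsWithin_le_nhds
    · filter_upwards [self_mem_nhdsWithin] with t ht
      exact ⟨ht, le_rfl, (stefanS_pos ν hlam hμ ht).le⟩
  exact h.neBot

theorem le_liminfAtOrigin_stefanU (hν₀ : 0 < ν) (hν₁ : ν < 1 / 2) (hlam : 0 < lam) (hq : 0 < q) :
    (C : EReal) ≤ liminfAtOrigin (stefanU (2 * ν) lam q C μ) (stefanS (2 * ν) lam μ) := by
  refine le_liminf_of_le (by isBoundedDefault) ?_
  filter_upwards [self_mem_nhdsWithin] with p hp
  exact EReal.coe_le_coe_iff.2 (stefanU_bounds hν₀ hν₁ hlam hq hp).1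

theorem limsupAtOrigin_stefanU_le (hν₀ : 0 < ν) (hν₁ : ν < 1 / 2) (hlam : 0 < lam) (hq : 0 < q) :
    limsupAtOrigin (stefanU (2 * ν) lam q C μ) (stefanS (2 * ν) lam μ) ≤
      ((C + q * lam * Real.Gamma (1 - ν) * (wrightPhi ν 1 0 - wrightPhi ν 1 μ) : ℝ) : EReal) := by
  refine limsup_le_of_le (by isBoundedDefault) ?_
  filter_upwards [self_mem_nhdsWithin] with p hp
  exact EReal.coe_le_coe_iff.2 (stefanU_bounds hν₀ hν₁ hlam hq hp).2

theorem solvesFluxStefan_stefanU {k : ℝ} (hν₀ : 0 < ν) (hν₁ : ν < 1 / 2) (hlam : 0 < lam)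
    (hk : 0 < k) (hq : 0 < q) (hμ : 0 < μ) (hJ : μ / wrightPhi ν (1 - ν) μ =
      k * q / lam * (Real.Gamma (1 - ν) ^ 2 / Real.Gamma (1 + ν))) (C : ℝ) :
    SolvesFluxStefan (2 * ν) lam k q C (stefanU (2 * ν) lam q C μ) (stefanS (2 * ν) lam μ) := by
  have hG := Real.Gamma_pos_of_pos (show 0 < 1 - ν by linarith)
  have hG' := Real.Gamma_pos_of_pos (show 0 < 1 + ν by linarith)
  have hν1 : ν < 1 := by linarith
  have hpow : ContinuousOn (fun t : ℝ => t ^ (ν - 1)) (Ioi 0) := fun t ht =>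
    (Real.continuousAt_rpow_const t _ (Or.inl (ne_of_gt ht))).continuousWithinAt
  have hpos_closed : ∀ p ∈ closedRegion (stefanS (2 * ν) lam μ), 0 < p.2 := fun p hp => hp.1
  have hpos_open : ∀ p ∈ openRegion (stefanS (2 * ν) lam μ), 0 < p.2 := fun p hp => hp.1
  have hsnd : ∀ D : Set (ℝ × ℝ), (∀ p ∈ D, 0 < p.2) →
      ContinuousOn (fun p : ℝ × ℝ => p.2 ^ ν) D := fun D hD =>
    continuousOn_snd.rpow_const fun p hp => Or.inl (hD p hp).ne'
  have huxx : ContinuousOn (fun p : ℝ × ℝ => spaceDeriv₂ (stefanU (2 * ν) lam q C μ) p.1 p.2)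
      (openRegion (stefanS (2 * ν) lam μ)) := by
    refine ContinuousOn.congr (f := fun p : ℝ × ℝ =>
      q * Real.Gamma (1 - ν) / (lam * p.2 ^ ν * p.2 ^ ν) *
        wrightPhi ν (1 - 2 * ν) (p.1 / (lam * p.2 ^ ν))) ?_
      fun p hp => (hasDerivAt_deriv_stefanU_space hν₀ hν₁ hlam hp.1 p.1).deriv
    refine (continuousOn_const.div ((continuousOn_const.mul (hsnd _ hpos_open)).mul
      (hsnd _ hpos_open)) fun p hp => ?_).mul (continuousOn_comp_similarity hlam
        (continuous_wrightPhi hν₀ hν1 (by linarith)) hpos_open)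
    have := Real.rpow_pos_of_pos hp.1 ν
    exact (mul_pos (mul_pos hlam this) this).ne'
  refine
    { s_pos := fun t ht => stefanS_pos ν hlam hμ ht
      u_space_diff := fun t ht x _ =>
        (hasDerivAt_stefanU_space hν₀ hν₁ hlam ht x).differentiableAt.differentiableWithinAt
      u_space_diff₂ := fun t ht x _ =>
        (hasDerivAt_deriv_stefanU_space hν₀ hν₁ hlam ht x).differentiableAt.differentiableWithinAt
      u_caputo := fun t x ht hx _ => caputoDifferentiableAt_stefanU hν₀ hν₁ hlam hx ht
      s_caputo := fun t ht => caputoDifferentiableAt_stefanS hν₀ hν₁ lam μ ht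
      diffusion := fun t x ht hx _ => caputoDeriv_stefanU hν₀ hν₁ hlam hx ht
      flux := fun t ht => ?_
      free_boundary := fun t ht => ?_
      stefan := fun t ht => ?_
      s_zero := ?_
      cont_uxx := huxx
      cont_caputo := ?_
      cont_u := ?_
      cont_ux := ?_
      liminf_gt := ?_
      liminf_le := ?_
      limsup_lt := ?_
      s_cont := ?_
      s_diff := fun t ht => (hasDerivAt_stefanS ν lam μ ht).differentiableAt.differentiableWithinAt
      s_deriv_cont := ?_
      s_integrable := fun t ht => ?_ }
  · rw [spaceDeriv_stefanU hν₀ hν₁ hlam hμ ht ⟨le_rfl, (stefanS_pos ν hlam hμ ht).le⟩, zero_div,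
      wrightPhi_zero, mul_div_cancel_left₀ ν two_ne_zero]
    have := Real.rpow_pos_of_pos ht ν
    field_simp
  · rw [stefanU_eq, stefanS_div ν hlam ht, sub_self, mul_zero, add_zero]
  · have htν := Real.rpow_pos_of_pos ht ν
    have hM : wrightPhi ν (1 - ν) μ ≠ 0 := fun h => by
      rw [h, div_zero] at hJ
      have : 0 < k * q / lam * (Real.Gamma (1 - ν) ^ 2 / Real.Gamma (1 + ν)) := by positivity
      exact this.ne hJ
    rw [caputoDeriv_stefanS hν₀ hν₁ lam μ ht, spaceDeriv_stefanU hν₀ hν₁ hlam hμ ht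
      ⟨(stefanS_pos ν hlam hμ ht).le, le_rfl⟩, stefanS_div ν hlam ht]
    -- Both sides of the Stefan condition are multiples of `t^(-ν)`; equality of the coefficients is
    -- the equation for `μ`.
    rw [div_eq_iff hM] at hJ
    generalize wrightPhi ν (1 - ν) μ = M at hJ
    rw [hJ]
    field_simp
  · rw [stefanS_eq, Real.zero_rpow hν₀.ne', mul_zero]
  · exact (continuousOn_const.mul huxx).congr fun p hp =>
      caputoDeriv_stefanU hν₀ hν₁ hlam hp.2.1 hp.1
  · simp_rw [stefanU_eq]
    exact continuousOn_const.add (continuousOn_const.mul ((continuousOn_comp_similarity hlam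
      (continuous_wrightPhi hν₀ hν1 le_rfl) hpos_closed).sub continuousOn_const))
  · refine ContinuousOn.congr (f := fun p : ℝ × ℝ => -(q * Real.Gamma (1 - ν) / p.2 ^ ν *
      wrightPhi ν (1 - ν) (p.1 / (lam * p.2 ^ ν)))) ?_ fun p hp =>
        spaceDeriv_stefanU hν₀ hν₁ hlam hμ hp.1 hp.2
    exact ((continuousOn_const.div (hsnd _ hpos_closed) fun p hp =>
      (Real.rpow_pos_of_pos hp.1 ν).ne').mul (continuousOn_comp_similarity hlam
        (continuous_wrightPhi hν₀ hν1 (by linarith)) hpos_closed)).neg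
  · exact (EReal.bot_lt_coe C).trans_le (le_liminfAtOrigin_stefanU hν₀ hν₁ hlam hq)
  · have := neBot_nhdsWithin_closedRegion ν hlam hμ
    exact liminf_le_limsup
  · exact (limsupAtOrigin_stefanU_le hν₀ hν₁ hlam hq).trans_lt (EReal.coe_lt_top _)
  · have h : stefanS (2 * ν) lam μ = fun t => lam * μ * t ^ ν := funext (stefanS_eq ν lam μ)
    rw [h]
    exact (continuous_const.mul (Real.continuous_rpow_const hν₀.le)).continuousOn
  · exact (continuousOn_const.mul (continuousOn_const.mul hpow)).congr fun t ht =>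
      (hasDerivAt_stefanS ν lam μ ht).deriv
  · have h := (caputoDifferentiableAt_stefanS hν₀ hν₁ lam μ ht).2
    rw [intervalIntegrable_iff_integrableOn_Ioo_of_le ht.le] at h
    refine h.congr_fun (fun τ hτ => ?_) measurableSet_Ioo
    simp only
    rw [Real.rpow_neg (sub_nonneg.2 hτ.2.le), div_eq_mul_inv, mul_comm]
end

theorem mainTheorem3 (α lam k q C : ℝ) (hα₀ : 0 < α) (hα₁ : α < 1)
    (hlam : 0 < lam) (hk : 0 < k) (hq : 0 < q) :
    (∃! μ : ℝ, 0 < μ ∧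
      stefanJ α μ = k * q / lam * (Real.Gamma (1 - α / 2) ^ 2 / Real.Gamma (1 + α / 2))) ∧
    ∀ μ : ℝ, 0 < μ →
      stefanJ α μ = k * q / lam * (Real.Gamma (1 - α / 2) ^ 2 / Real.Gamma (1 + α / 2)) →
      SolvesFluxStefan α lam k q C (stefanU α lam q C μ) (stefanS α lam μ) ∧
      (0 ≤ C → IsFluxStefanSolution α lam k q C (stefanU α lam q C μ) (stefanS α lam μ)) := by
  obtain ⟨ν, rfl⟩ : ∃ ν, α = 2 * ν := ⟨α / 2, by ring⟩
  rw [mul_div_cancel_left₀ ν two_ne_zero]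
  have hν₀ : 0 < ν := by linarith
  have hν₁ : ν < 1 / 2 := by linarith
  have hJ : ∀ μ, stefanJ (2 * ν) μ = μ / wrightPhi ν (1 - ν) μ := fun μ => by
    rw [stefanJ, mul_div_cancel_left₀ ν two_ne_zero]; rfl
  have hG := Real.Gamma_pos_of_pos (show 0 < 1 - ν by linarith)
  have hG' := Real.Gamma_pos_of_pos (show 0 < 1 + ν by linarith)
  simp_rw [hJ]
  refine ⟨existsUnique_div_wrightPhi_eq hν₀ hν₁ (by positivity), fun μ hμ hμJ => ?_⟩
  have hsol := solvesFluxStefan_stefanU hν₀ hν₁ hlam hk hq hμ hμJ C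
  exact ⟨hsol, fun hC => ⟨hsol, (EReal.coe_nonneg.2 hC).trans
    (le_liminfAtOrigin_stefanU hν₀ hν₁ hlam hq)⟩⟩
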